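/- Let $\Delta$ be a reduced crystallographic root system with a choice of simple roots, let $W$ be its Weyl group with set of simple reflections $S$ (identified with the simple roots) and length function $\ell$, and let $\leq$ be the strong Bruhat order. For $w\in W$ put $\Delta_w=\{\alpha\in\Delta:\alpha>0,\ w(\alpha)<0\}$, let $\mathcal A_w$ be the arrangement of the hyperplanes $\alpha(x)=0$, $\alpha\in\Delta_w$, and let $P_w(q)=\sum_{u\le w}q^{\ell(u)}$. The arrangements below consist of hyperplanes of roots; the fundamental chamber $r_0$ of such an arrangement $\mathcal A$ is the chamber on which all positive roots whose hyperplane lies in $\mathcal A$ are positive. Let $d(r,r')$ be the number of hyperplanes separating the chambers $r,r'$, and let $Q_{\mathcal A}$ be the poset of chambers of $\mathcal A$ generated by the relations $r\lessdot r'$ whenever $r,r'$ are adjacent (separated by exactly one hyperplane) and $d(r_0,r')=d(r_0,r)+1$. For $\mathcal A'\subseteq\mathcal A$ and a chamber $r$ of $\mathcal A'$, let $Q_{\mathcal A,\mathcal A',r}$ be the induced subposet of $Q_{\mathcal A}$ on the chambers of $\mathcal A$ contained in $r$; $\mathcal A$ is *uniform* over $\mathcal A'$ if the posets $Q_{\mathcal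 A,\mathcal A',r}$, for $r$ a chamber of $\mathcal A'$, are all isomorphic. Let $R_w(q)=\sum_r q^{d(r_0,r)}$, the sum over all chambers $r$ of $\mathcal A_w$. Let $\alpha\in S$ be a leaf of the Dynkin diagram (a node with at most one neighbour), $J=S\setminus\{\alpha\}$, and let $w=uv$ be a BP-decomposition with respect to $J$: $u\in W_J$, $v$ is a minimal length representative of its coset in $W_J\backslash W$, and $u$ is the greatest element of $W_J$ below $w$ in Bruhat order. Let $I\subseteq S$ be the set of simple reflections appearing in a reduced word of $v$, and let $u_{I\cap J}$ be the longest element of $W_{I\cap J}$. Let $v^{-1}$ act on hyperplanes by sending $\{\beta=0\}$ to $\{v^{-1}\beta=0\}$, and put $$\mathcal A_0=v^{-1}\mathcal A_{u_{I\cap J}},\qquad \mathcal A_1=v^{-1}\mathcal A_u\setminus\mathcal A_0,\qquad \mathcal A_2=\mathcal A_w\setminus v^{-1}\mathcal A_u .$$ Then: 1. $u=u'u_{I\cap J}$ for some $u'\in W$ with $\ell(u)=\ell(u')+\ell(u_{I\cap J})$, and $\mathcal A_w=\mathcal A_0\sqcup\mathcal A_1\sqcup\mathcal A_2$, $\mathcal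 A_0\sqcup\mathcal A_1=v^{-1}\mathcal A_u$, $\mathcal A_0\sqcup\mathcal A_2=\mathcal A_{u_{I\cap J}v}$. 2. For every chamber $r$ of $\mathcal A_1\sqcup\mathcal A_0$, if $r'$ is the chamber of $\mathcal A_0$ containing $r$, then $Q_{\mathcal A_w,\ \mathcal A_1\sqcup\mathcal A_0,\ r}\cong Q_{\mathcal A_0\sqcup\mathcal A_2,\ \mathcal A_0,\ r'}$. 3. If $\mathcal A_{u_{I\cap J}v}$ is uniform over $\mathcal A_0=v^{-1}\mathcal A_{u_{I\cap J}}$, $R_{u_{I\cap J}v}=P_{u_{I\cap J}v}$ and $R_u=P_u$, then $R_w=P_w$ and $R_{w^{-1}}=P_{w^{-1}}$. -/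

import Mathlib

open scoped Polynomial

noncomputable section

/-! ### Central hyperplane arrangements, chambers and the poset of chambers -/

namespace Arrangement

variable {V : Type*} [AddCommGroup V] [Module ℝ V]

/-- The chamber of the arrangement `𝒜` through the point `x`: all points that can be joined to
`x` by a line segment missing every hyperplane of `𝒜`.  When `x` lies on no hyperplane of `𝒜`,
this is the (convex) connected component of `x` in the complement of the hyperplanes. -/
def chamberAt (𝒜 : Set (Submodule ℝ V)) (x : V) : Set V :=
  {y | ∀ H ∈ 𝒜, Disjoint (segment ℝ x y) (H : Set V)}

/-- The chambers (regions) of a central arrangement `𝒜`. -/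
@[ext]
structure Chamber (𝒜 : Set (Submodule ℝ V)) where
  carrier : Set V
  exists_eq : ∃ x : V, (∀ H ∈ 𝒜, x ∉ H) ∧ carrier = chamberAt 𝒜 x

/-- The hyperplane `H` separates the regions `C` and `D`. -/
def Separates (H : Submodule ℝ V) (C D : Set V) : Prop :=
  ∀ x ∈ C, ∀ y ∈ D, (segment ℝ x y ∩ (H : Set V)).Nonempty

/-- The hyperplanes of `𝒜` that separate `C` and `D`. -/
def sepSet (𝒜 : Set (Submodule ℝ V)) (C D : Set V) : Set (Submodule ℝ V) :=
  {H ∈ 𝒜 | Separates H C D}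

/-- The distance `d(C, D)`: the number of hyperplanes of `𝒜` separating `C` and `D`. -/
def dist (𝒜 : Set (Submodule ℝ V)) (C D : Set V) : ℕ :=
  (sepSet 𝒜 C D).ncard

/-- Two chambers are adjacent if they are separated by exactly one hyperplane. -/
def Adjacent (𝒜 : Set (Submodule ℝ V)) (C D : Set V) : Prop :=
  ∃ H, sepSet 𝒜 C D = {H}

/-- The covering relation `C ⋖ D` on chambers determined by the fundamental chamber `r₀`:
`C` and `D` are adjacent and `d(r₀, D) = d(r₀, C) + 1`. -/
def Covers (𝒜 : Set (Submodule ℝ V)) (r₀ : Set V) (C D : Chamber 𝒜) : Prop :=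
  Adjacent 𝒜 C.carrier D.carrier ∧ dist 𝒜 r₀ D.carrier = dist 𝒜 r₀ C.carrier + 1

/-- The set of chambers of `𝒜`, to be ordered with respect to the fundamental chamber `r₀`. -/
def ChamberPoset (𝒜 : Set (Submodule ℝ V)) (_r₀ : Set V) : Type _ := Chamber 𝒜

theorem dist_le_of_reflTransGen {𝒜 : Set (Submodule ℝ V)} {r₀ : Set V} {C D : Chamber 𝒜}
    (h : Relation.ReflTransGen (Covers 𝒜 r₀) C D) :
    C = D ∨ dist 𝒜 r₀ C.carrier < dist 𝒜 r₀ D.carrier := by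
  induction h with
  | refl => exact Or.inl rfl
  | tail _ hc ih =>
    right
    have h2 := hc.2
    rcases ih with rfl | ih <;> omega

/-- The chamber poset `Q_𝒜`: the order generated by the covering relation. -/
instance (𝒜 : Set (Submodule ℝ V)) (r₀ : Set V) : PartialOrder (ChamberPoset 𝒜 r₀) where
  le C D := Relation.ReflTransGen (Covers 𝒜 r₀) C D
  le_refl _ := Relation.ReflTransGen.refl
  le_trans _ _ _ h₁ h₂ := Relation.ReflTransGen.trans h₁ h₂
  le_antisymm C D h₁ h₂ := by
    rcases dist_le_of_reflTransGen h₁ with h | h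
    · exact h
    · rcases dist_le_of_reflTransGen h₂ with h' | h'
      · exact h'.symm
      · exact absurd h (not_lt.mpr h'.le)

/-- The induced subposet of `Q_𝒜` on the chambers of `𝒜` contained in the region `r`. -/
abbrev InducedPoset (𝒜 : Set (Submodule ℝ V)) (r₀ : Set V) (r : Set V) : Type _ :=
  {C : ChamberPoset 𝒜 r₀ // Chamber.carrier C ⊆ r}

/-- `𝒜` (with fundamental chamber `r₀`) is uniform with respect to `𝒜'`: the induced subposets
on the chambers of `𝒜` inside `r`, for `r` a chamber of `𝒜'`, are all isomorphic. -/
def Uniform (𝒜 : Set (Submodule ℝ V)) (r₀ : Set V) (𝒜' : Set (Submodule ℝ V)) : Prop :=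
  ∀ r r' : Chamber 𝒜', Nonempty (InducedPoset 𝒜 r₀ r.carrier ≃o InducedPoset 𝒜 r₀ r'.carrier)

/-- The distance enumerating polynomial `∑_r q ^ d(r₀, r)`, over all chambers `r` of `𝒜`
(a finite set whenever `𝒜` is finite). -/
def distPoly (𝒜 : Set (Submodule ℝ V)) (r₀ : Set V) : ℤ[X] :=
  ∑ᶠ r : Chamber 𝒜, Polynomial.X ^ dist 𝒜 r₀ r.carrier

end Arrangement

/-! ### The Weyl group of a root system with a base -/

namespace Weyl

variable {ι M N : Type*} [AddCommGroup M] [Module ℝ M] [AddCommGroup N] [Module ℝ N]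
  {P : RootPairing ι ℝ M N}

/-- The simple reflections, indexed by the simple roots. -/
def simple (b : P.Base) (i : b.support) : P.weylGroup :=
  RootPairing.weylGroup.ofIdx P i

/-- The product of the simple reflections in a word. -/
def wordProd (b : P.Base) (l : List b.support) : P.weylGroup :=
  (l.map (simple b)).prod

/-- The length of `w`: the least length of a word in the simple reflections with product `w`. -/
def length (b : P.Base) (w : P.weylGroup) : ℕ :=
  sInf {n | ∃ l : List b.support, wordProd b l = w ∧ l.length = n}

/-- The word `l` is a reduced word of `w`. -/
def IsReducedWord (b : P.Base) (w : P.weylGroup) (l : List b.support) : Prop :=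
  wordProd b l = w ∧ l.length = length b w

/-- The simple roots whose reflections appear in a reduced word of `w`. -/
def wordSupport (b : P.Base) (w : P.weylGroup) : Set b.support :=
  {i | ∃ l, IsReducedWord b w l ∧ i ∈ l}

/-- The set `T` of reflections: conjugates of simple reflections. -/
def reflections (b : P.Base) : Set P.weylGroup :=
  {t | ∃ (g : P.weylGroup) (i : b.support), t = g * simple b i * g⁻¹}

/-- The strong Bruhat order: generated by `x < x * t` for reflections `t` with
`ℓ(x) < ℓ(x * t)`. -/
def BruhatLE (b : P.Base) : P.weylGroup → P.weylGroup → Prop :=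
  Relation.ReflTransGen fun x y => ∃ t ∈ reflections b, y = x * t ∧ length b x < length b y

/-- The Poincaré polynomial `P_w(q) = ∑_{u ≤ w} q ^ ℓ(u)`. -/
def poincarePoly (b : P.Base) (w : P.weylGroup) : ℤ[X] :=
  ∑ᶠ u : {u : P.weylGroup // BruhatLE b u w}, Polynomial.X ^ length b u.1

/-- The standard parabolic subgroup `W_J`. -/
def parabolic (b : P.Base) (J : Set b.support) : Subgroup P.weylGroup :=
  Subgroup.closure (simple b '' J)

/-- The set `ᴶW` of minimal length representatives of the cosets `W_J \ W`. -/
def minCosetReps (b : P.Base) (J : Set b.support) : Set P.weylGroup :=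
  {v | ∀ x ∈ parabolic b J, length b v ≤ length b (x * v)}

/-- `x` is the longest element of `W_K`. -/
def IsLongest (b : P.Base) (K : Set b.support) (x : P.weylGroup) : Prop :=
  x ∈ parabolic b K ∧ ∀ y ∈ parabolic b K, length b y ≤ length b x

/-- `u` is `m(w, J)`, the greatest element of `W_J` below `w` in Bruhat order. -/
def IsMaxBelow (b : P.Base) (w : P.weylGroup) (J : Set b.support) (u : P.weylGroup) : Prop :=
  u ∈ parabolic b J ∧ BruhatLE b u w ∧
    ∀ x ∈ parabolic b J, BruhatLE b x w → BruhatLE b x u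

/-- `α` is a leaf of the Dynkin diagram: it is joined to at most one other node (a diagram
with a single node counts). -/
def IsLeaf (b : P.Base) (α : b.support) : Prop :=
  {β : b.support | β ≠ α ∧ P.pairing α β ≠ 0}.Subsingleton

/-- `w = u v` is a BP-decomposition with respect to `J = S \ {α}`: `α` is a leaf,
`u ∈ W_J`, `v ∈ ᴶW`, and `u = m(w, J)`. -/
structure IsBPDecomposition (b : P.Base) (α : b.support) (w u v : P.weylGroup) : Prop where
  leaf : IsLeaf b α
  eq_mul : w = u * v
  left_mem : u ∈ parabolic b {α}ᶜ
  right_mem : v ∈ minCosetReps b {α}ᶜ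
  isMax : IsMaxBelow b w {α}ᶜ u

/-- The inversion set `Δ_w` of positive roots that `w` makes negative (a root is negative if and
only if it is not positive); roots are represented by their indices. -/
def inversions (b : P.Base) (w : P.weylGroup) : Set ι :=
  {i | b.IsPos i ∧ ¬ b.IsPos (w • i)}

/-- The hyperplane `α(x) = 0` of a root `α`. -/
def hyperplane (P : RootPairing ι ℝ M N) (i : ι) : Submodule ℝ N :=
  LinearMap.ker (P.root' i)

/-- The inversion hyperplane arrangement `𝒜_w`. -/
def inversionArr (b : P.Base) (w : P.weylGroup) : Set (Submodule ℝ N) :=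
  hyperplane P '' inversions b w

/-- The image `g 𝒜_w` of the inversion arrangement `𝒜_w` under `g ∈ W`: the hyperplanes of the
roots `g α`, for `α ∈ Δ_w`. -/
def translatedArr (b : P.Base) (g w : P.weylGroup) : Set (Submodule ℝ N) :=
  (fun i => hyperplane P (g • i)) '' inversions b w

/-- The fundamental chamber of an arrangement of root hyperplanes: the points at which every
positive root whose hyperplane belongs to the arrangement is positive. -/
def fundamentalChamber (b : P.Base) (𝒜 : Set (Submodule ℝ N)) : Set N :=
  {x | ∀ i, b.IsPos i → hyperplane P i ∈ 𝒜 → 0 < P.root' i x}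

/-- The distance enumerating polynomial `R_w(q) = ∑_r q ^ d(r₀, r)` of `𝒜_w`. -/
def distPoly (b : P.Base) (w : P.weylGroup) : ℤ[X] :=
  Arrangement.distPoly (inversionArr b w) (fundamentalChamber b (inversionArr b w))

end Weyl

end

open scoped Polynomial

noncomputable section

namespace Weyl

open RootPairing

variable {ι M N : Type*} [AddCommGroup M] [Module ℝ M] [AddCommGroup N] [Module ℝ N]
  {P : RootPairing ι ℝ M N}

set_option linter.unusedSectionVars false

/-! ### The Weyl group acting on root indices and on points. -/

section Action

/-! A chamber of an arrangement of positive roots is determined by the set of roots negative on it.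
In these terms the distance to the fundamental chamber is a cardinality, and a cover adds one root
(`covers_iff`). If `B` and `D` are disjoint sets of positive roots, the chambers of `B ∪ D` inside a
chamber of `B` with negative set `n` form a family `fibre P B n D` of subsets of `D`. The induced
order is again generated by adding one root (`stepLE_inducedEquiv_iff`).

Let `I` be the support of `v`. Then `Inv(uv) = v⁻¹Inv(u) ⊔ Inv(v)`. Maximality of `u` puts every
positive root of `I ∩ J` into `Inv(u)`: for `k ∈ I ∩ J` one has `u s_k ≤ uv`, hence `u s_k ≤ u`
(`posRoots_subset_of_isMaxBelow`). This gives the factorization of `u` and the three arrangements.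

For the posets, translate by `v`: the roots of `v⁻¹Inv(u)` move into `Φ_J` and those of `Inv(v)`
into `Φ_I`. A chamber of `Φ_I` and a chamber of `Φ_J` that agree on `Φ_{I ∩ J}` have a common
refinement (`exists_amalgam`), which follows from interpolation in the weak order
(`exists_inversions_between`). So the fibre over a chamber of `v⁻¹𝒜_u` depends only on the chamber
of `𝒜₀` containing it.

For the polynomials, `P_{uv} = P_u · G'` and `P_{u₀v} = P_{u₀} · G'`, where `G'` enumerates the
minimal coset representatives below `v` (`poincarePoly_mul`). Uniformity gives all fibres one rank
polynomial `G`, because they are graded by cardinality with least element `∅`, so order isomorphisms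
preserve cardinality. Hence `R_{u₀v} = R_{u₀} · G` and `R_{uv} = R_u · G`. Since `R_{u₀} = P_{u₀} ≠
0`, cancellation gives `G = G'`. Inverses are harmless: `Inv(w⁻¹) = -w Inv(w)`, and inversion
preserves length and Bruhat order. -/

theorem root_smul (g : P.weylGroup) (i : ι) : P.root (g • i) = g • P.root i :=
  (weylGroup_apply_root P g i).symm

theorem ofIdx_smul_idx (j i : ι) : weylGroup.ofIdx P j • i = P.reflectionPerm j i := rfl

theorem root_neg (i : ι) : P.root (P.reflectionPerm i i) = -P.root i := by simp

theorem smul_neg (g : P.weylGroup) (i : ι) :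
    g • P.reflectionPerm i i = P.reflectionPerm (g • i) (g • i) := by
  apply P.root.injective
  rw [root_smul, root_neg, root_neg, root_smul, _root_.smul_neg]

theorem ofIdx_mul_self (i : ι) : weylGroup.ofIdx P i * weylGroup.ofIdx P i = 1 := by
  apply Subtype.ext
  change Equiv.reflection P i * Equiv.reflection P i = 1
  rw [mul_eq_one_iff_inv_eq, Equiv.reflection_inv]

theorem ofIdx_inv (i : ι) : (weylGroup.ofIdx P i)⁻¹ = weylGroup.ofIdx P i :=
  inv_eq_of_mul_eq_one_left (ofIdx_mul_self i)

theorem eq_of_smul_eq {g h : P.weylGroup} (H : ∀ x : M, g • x = h • x) : g = h := by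
  apply Subtype.ext
  apply Equiv.weightHom_injective P
  ext x
  exact H x

theorem ofIdx_reflectionPerm (i j : ι) :
    weylGroup.ofIdx P (P.reflectionPerm j i) =
      weylGroup.ofIdx P j * weylGroup.ofIdx P i * weylGroup.ofIdx P j := by
  apply eq_of_smul_eq
  intro x
  have := congrArg (fun f : M ≃ₗ[ℝ] M => f x) (P.reflection_reflectionPerm (i := i) (j := j))
  exact this

theorem ofIdx_neg (i : ι) : weylGroup.ofIdx P (P.reflectionPerm i i) = weylGroup.ofIdx P i := by
  rw [ofIdx_reflectionPerm, ofIdx_mul_self, one_mul]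

theorem ofIdx_smul_eq (g : P.weylGroup) (i : ι) :
    weylGroup.ofIdx P (g • i) = g * weylGroup.ofIdx P i * g⁻¹ := by
  obtain ⟨g, hg⟩ := g
  induction hg using weylGroup.induction generalizing i with
  | mem j =>
    have := ofIdx_reflectionPerm (P := P) i j
    rw [← ofIdx_smul_idx] at this
    change weylGroup.ofIdx P (weylGroup.ofIdx P j • i) = weylGroup.ofIdx P j * _ *
      (weylGroup.ofIdx P j)⁻¹
    rw [this, ofIdx_inv]
  | one =>
    change weylGroup.ofIdx P ((1 : P.weylGroup) • i) = (1 : P.weylGroup) * _ * (1 : P.weylGroup)⁻¹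
    simp
  | mul x y hx hy ihx ihy =>
    rw [← Submonoid.mk_mul_mk _ x y hx hy]
    change weylGroup.ofIdx P (((⟨x, hx⟩ : P.weylGroup) * (⟨y, hy⟩ : P.weylGroup)) • i) =
      ((⟨x, hx⟩ : P.weylGroup) * (⟨y, hy⟩ : P.weylGroup)) * _ *
      ((⟨x, hx⟩ : P.weylGroup) * (⟨y, hy⟩ : P.weylGroup))⁻¹
    rw [mul_smul, ihx, ihy]
    group

theorem eq_one_of_smul_idx [P.IsRootSystem] {g : P.weylGroup} (H : ∀ i : ι, g • i = i) :
    g = 1 := by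
  apply eq_of_smul_eq
  intro x
  have hx : x ∈ Submodule.span ℝ (Set.range P.root) := by
    rw [IsRootSystem.span_root_eq_top]; trivial
  rw [one_smul]
  induction hx using Submodule.span_induction with
  | mem x h =>
    obtain ⟨i, rfl⟩ := h
    rw [← root_smul, H]
  | zero => exact smul_zero g
  | add x y _ _ hx hy => rw [smul_add, hx, hy]
  | smul a x _ hx => rw [smul_comm, hx]

theorem finite_weylGroup [Finite ι] [P.IsRootSystem] : Finite P.weylGroup := by
  apply Finite.of_injective (fun (g : P.weylGroup) (i : ι) => g • i)
  intro g h H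
  have : h⁻¹ * g = 1 := eq_one_of_smul_idx fun i => by
    rw [mul_smul, inv_smul_eq_iff]; exact congrFun H i
  exact (inv_mul_eq_one.mp this).symm

/-- The point `g x`, for `g` in the Weyl group and `x` in the space carrying the arrangements. -/
def act (g : P.weylGroup) (x : N) : N := (g⁻¹).1.toHom.coweightMap x

theorem root'_coweight (g : P.weylGroup) (i : ι) (x : N) :
    P.root' i (g.1.toHom.coweightMap x) = P.root' (g • i) x := by
  have h := Hom.weight_coweight_transpose_apply P P x g.1.toHom
  have h2 := LinearMap.congr_fun h (P.root i)
  have h3 := root_smul g i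
  rw [root', root', h3]
  exact h2.symm

theorem root'_act (g : P.weylGroup) (i : ι) (x : N) :
    P.root' i (act g x) = P.root' (g⁻¹ • i) x :=
  root'_coweight g⁻¹ i x

end Action

/-! ### Coordinates of roots in the base. -/

section Coeff

variable [P.IsRootSystem] (b : P.Base)

/-- The coefficient of the simple root `k` in the root `i`. -/
def coeff (i : ι) (k : b.support) : ℝ := b.toWeightBasis.repr (P.root i) k

theorem coeff_simple_self (k : b.support) : coeff b k k = 1 := by simp [coeff]

theorem coeff_simple_of_ne {k l : b.support} (h : k ≠ l) : coeff b k l = 0 := by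
  simp [coeff, h]

theorem coeff_add {i j k : ι} (h : P.root k = P.root i + P.root j) (l : b.support) :
    coeff b k l = coeff b i l + coeff b j l := by
  simp [coeff, h]

theorem coeff_neg (i : ι) (l : b.support) :
    coeff b (P.reflectionPerm i i) l = -coeff b i l := by
  simp [coeff]

theorem root_eq_sum_coeff (i : ι) : P.root i = ∑ k, coeff b i k • P.root k := by
  conv_lhs => rw [← b.toWeightBasis.sum_repr (P.root i)]
  simp [coeff]

theorem root'_eq_sum_coeff (i : ι) (x : N) :
    P.root' i x = ∑ k : b.support, coeff b i k * P.root' k x := by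
  change P.toLinearMap (P.root i) x = _
  conv_lhs => rw [root_eq_sum_coeff b i]
  simp

/-- The simple roots are a basis and the pairing is perfect, so their values at a point can be
prescribed freely. -/
theorem exists_root'_eq (h : b.support → ℝ) : ∃ x : N, ∀ k : b.support, P.root' k x = h k := by
  let f : Module.Dual ℝ M := b.toWeightBasis.constr ℝ h
  refine ⟨P.flip.toPerfPair.symm f, fun k => ?_⟩
  have h1 : P.flip.toPerfPair (P.flip.toPerfPair.symm f) (P.root k) = f (P.root k) := by
    rw [LinearEquiv.apply_symm_apply]
  have h2 : f (P.root k) = h k := by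
    rw [← b.toWeightBasis_apply k]
    exact b.toWeightBasis.constr_basis ℝ h k
  rw [← h2, ← h1]
  rfl

variable [Finite ι] [P.IsCrystallographic]

theorem coeff_nonneg {i : ι} (hi : b.IsPos i) (k : b.support) : 0 ≤ coeff b i k := by
  refine hi.induction_on_add (p := fun i => 0 ≤ coeff b i k) (fun i hi => ?_)
    (fun i j k' hk h hj => ?_)
  · by_cases h : (⟨i, hi⟩ : b.support) = k
    · subst h; rw [coeff_simple_self b ⟨i, hi⟩]; exact zero_le_one
    · rw [coeff_simple_of_ne b h]
  · rw [coeff_add b hk]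
    refine add_nonneg h ?_
    by_cases h : (⟨j, hj⟩ : b.support) = k
    · subst h; rw [coeff_simple_self b ⟨j, hj⟩]; exact zero_le_one
    · rw [coeff_simple_of_ne b h]

end Coeff

/-! ### Positive roots and a dominant regular point. -/

section Pos

variable (b : P.Base)

theorem isPos_neg_iff (i : ι) : b.IsPos (P.reflectionPerm i i) ↔ ¬ b.IsPos i :=
  Base.IsPos.neg_iff_not b i

theorem isPos_simple (k : b.support) : b.IsPos (k : ι) := Base.isPos_of_mem_support k.2

variable [P.IsRootSystem] [Finite ι] [P.IsCrystallographic]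

theorem exists_coeff_pos {i : ι} (hi : b.IsPos i) : ∃ k, 0 < coeff b i k := by
  by_contra! h
  apply P.ne_zero i
  rw [root_eq_sum_coeff b i]
  exact Finset.sum_eq_zero fun k _ => by
    rw [le_antisymm (h k) (coeff_nonneg b hi k), zero_smul]

theorem isPos_of_coeff_pos {i : ι} {k : b.support} (h : 0 < coeff b i k) : b.IsPos i := by
  by_contra hi
  rw [← isPos_neg_iff] at hi
  have := coeff_nonneg b hi k
  rw [coeff_neg] at this
  linarith

theorem coeff_nonpos {i : ι} (hi : ¬ b.IsPos i) (k : b.support) : coeff b i k ≤ 0 := by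
  by_contra! h
  exact hi (isPos_of_coeff_pos b h)

/-- Sums of roots that are positive at a point of `N`. -/
theorem root'_pos_of_isPos {x : N} (hx : ∀ k : b.support, 0 < P.root' k x) {i : ι}
    (hi : b.IsPos i) : 0 < P.root' i x := by
  rw [root'_eq_sum_coeff b]
  obtain ⟨k, hk⟩ := exists_coeff_pos b hi
  exact Finset.sum_pos' (fun l _ => mul_nonneg (coeff_nonneg b hi l) (hx l).le)
    ⟨k, Finset.mem_univ k, mul_pos hk (hx k)⟩

theorem exists_dominant : ∃ x : N, ∀ i, b.IsPos i ↔ 0 < P.root' i x := by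
  obtain ⟨x, hx⟩ := exists_root'_eq b (fun _ => 1)
  have hx' : ∀ k : b.support, 0 < P.root' k x := fun k => by rw [hx]; exact one_pos
  refine ⟨x, fun i => ⟨fun hi => root'_pos_of_isPos b hx' hi, fun h => ?_⟩⟩
  by_contra hi
  rw [← isPos_neg_iff] at hi
  have := root'_pos_of_isPos b hx' hi
  rw [root', root_neg, map_neg, LinearMap.neg_apply] at this
  exact lt_asymm h (neg_pos.mp this)

variable [P.IsReduced]

theorem simple_smul_isPos {k : b.support} {i : ι} (hi : b.IsPos i) (hik : i ≠ k) :
    b.IsPos (simple b k • i) :=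
  hi.reflectionPerm k.2 hik

theorem simple_mul_self (k : b.support) : simple b k * simple b k = 1 := ofIdx_mul_self _

theorem simple_inv (k : b.support) : (simple b k)⁻¹ = simple b k := ofIdx_inv _

theorem simple_smul_self (k : b.support) : simple b k • (k : ι) = P.reflectionPerm k k := rfl

theorem coeff_smul_simple {k l : b.support} (h : k ≠ l) (i : ι) :
    coeff b (simple b k • i) l = coeff b i l := by
  change coeff b (P.reflectionPerm k i) l = _
  rw [coeff, root_reflectionPerm, reflection_apply, map_sub, map_smul]
  simp [h, coeff]

theorem eq_simple_of_simple_smul_not_isPos {k : b.support} {i : ι} (hi : b.IsPos i)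
    (h : ¬ b.IsPos (simple b k • i)) : i = k := by
  by_contra hik
  exact h (simple_smul_isPos b hi hik)

end Pos

/-! ### Length and the exchange property. -/

section Length

variable [Finite ι] [P.IsRootSystem] [P.IsCrystallographic] [P.IsReduced] (b : P.Base)

theorem wordProd_nil : wordProd b [] = 1 := rfl

theorem wordProd_cons (k : b.support) (l : List b.support) :
    wordProd b (k :: l) = simple b k * wordProd b l := by simp [wordProd]

theorem wordProd_append (l l' : List b.support) :
    wordProd b (l ++ l') = wordProd b l * wordProd b l' := by simp [wordProd]

theorem wordProd_singleton (k : b.support) : wordProd b [k] = simple b k := by simp [wordProd]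

theorem wordProd_reverse (l : List b.support) :
    wordProd b l.reverse = (wordProd b l)⁻¹ := by
  induction l with
  | nil => simp [wordProd]
  | cons k l ih =>
    rw [List.reverse_cons, wordProd_append, ih, wordProd_singleton, wordProd_cons, mul_inv_rev,
      simple_inv]

theorem exists_wordProd_ofIdx (i : ι) : ∃ l, wordProd b l = weylGroup.ofIdx P i := by
  have key : ∀ i, b.IsPos i → ∃ l, wordProd b l = weylGroup.ofIdx P i := fun i hi => by
    refine hi.induction_on_reflect (p := fun i => ∃ l, wordProd b l = weylGroup.ofIdx P i)
      (fun k hk => ⟨[⟨k, hk⟩], wordProd_singleton b _⟩) ?_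
    rintro i j ⟨l, hl⟩ hj
    refine ⟨[⟨j, hj⟩] ++ l ++ [⟨j, hj⟩], ?_⟩
    rw [wordProd_append, wordProd_append, wordProd_singleton, hl, ofIdx_reflectionPerm]
    rfl
  by_cases hi : b.IsPos i
  · exact key i hi
  · rw [← isPos_neg_iff] at hi
    rw [← ofIdx_neg]
    exact key _ hi

theorem exists_wordProd (w : P.weylGroup) : ∃ l, wordProd b l = w := by
  obtain ⟨g, hg⟩ := w
  induction hg using weylGroup.induction with
  | mem j => exact exists_wordProd_ofIdx b j
  | one => exact ⟨[], rfl⟩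
  | mul x y hx hy ihx ihy =>
    obtain ⟨l, hl⟩ := ihx
    obtain ⟨l', hl'⟩ := ihy
    exact ⟨l ++ l', by rw [wordProd_append, hl, hl']; rfl⟩

theorem length_wordProd_le (l : List b.support) : length b (wordProd b l) ≤ l.length :=
  Nat.sInf_le ⟨l, rfl, rfl⟩

theorem exists_isReducedWord (w : P.weylGroup) : ∃ l, IsReducedWord b w l := by
  have h : {n | ∃ l : List b.support, wordProd b l = w ∧ l.length = n}.Nonempty := by
    obtain ⟨l, hl⟩ := exists_wordProd b w
    exact ⟨_, l, hl, rfl⟩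
  exact Nat.sInf_mem h

theorem length_one : length b (1 : P.weylGroup) = 0 :=
  Nat.le_zero.mp (length_wordProd_le b [])

theorem eq_one_of_length_eq_zero {w : P.weylGroup} (h : length b w = 0) : w = 1 := by
  obtain ⟨l, hl, hl'⟩ := exists_isReducedWord b w
  rw [h, List.length_eq_zero_iff] at hl'
  rw [← hl, hl', wordProd_nil]

theorem length_mul_le (g h : P.weylGroup) : length b (g * h) ≤ length b g + length b h := by
  obtain ⟨l, hl, hl'⟩ := exists_isReducedWord b g
  obtain ⟨m, hm, hm'⟩ := exists_isReducedWord b h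
  have := length_wordProd_le b (l ++ m)
  rwa [wordProd_append, hl, hm, List.length_append, hl', hm'] at this

theorem length_inv (g : P.weylGroup) : length b g⁻¹ = length b g := by
  have key : ∀ g : P.weylGroup, length b g⁻¹ ≤ length b g := fun g => by
    obtain ⟨l, hl, hl'⟩ := exists_isReducedWord b g
    have := length_wordProd_le b l.reverse
    rwa [wordProd_reverse, hl, List.length_reverse, hl'] at this
  exact le_antisymm (key g) (by simpa using key g⁻¹)

theorem length_simple_le (k : b.support) : length b (simple b k) ≤ 1 := by
  have := length_wordProd_le b [k]
  rwa [wordProd_singleton] at this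

/-- The strong exchange property. -/
theorem exists_wordProd_eq_mul_ofIdx (l : List b.support) {j : ι} (hj : b.IsPos j)
    (h : ¬ b.IsPos (wordProd b l • j)) :
    ∃ l' : List b.support, l'.length + 1 = l.length ∧
      (∀ k ∈ l', k ∈ l) ∧ wordProd b l * weylGroup.ofIdx P j = wordProd b l' := by
  induction l with
  | nil => rw [wordProd_nil, one_smul] at h; exact absurd hj h
  | cons k l ih =>
    -- Find the letter `k` at which the image of `j` turns negative. Just before it the image must
    -- be the simple root `k`, so `s_k` is a conjugate of the reflection in `j`, and multiplying by
    -- that reflection deletes this letter.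
    by_cases h' : b.IsPos (wordProd b l • j)
    · rw [wordProd_cons, mul_smul] at h
      have h2 := eq_simple_of_simple_smul_not_isPos b h' h
      refine ⟨l, rfl, fun _ => List.mem_cons_of_mem _, ?_⟩
      have h3 : simple b k = wordProd b l * weylGroup.ofIdx P j * (wordProd b l)⁻¹ := by
        rw [← ofIdx_smul_eq, h2]; rfl
      rw [wordProd_cons, h3, inv_mul_cancel_right, mul_assoc, ofIdx_mul_self, mul_one]
    · obtain ⟨l', h1, h2, h3⟩ := ih h'
      refine ⟨k :: l', by simp [h1], fun x hx => ?_, by rw [wordProd_cons, wordProd_cons, ← h3, mul_assoc]⟩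
      rcases List.mem_cons.mp hx with rfl | hx
      · exact List.mem_cons_self
      · exact List.mem_cons_of_mem _ (h2 x hx)

theorem length_mul_ofIdx_lt {w : P.weylGroup} {j : ι} (hj : b.IsPos j)
    (h : ¬ b.IsPos (w • j)) : length b (w * weylGroup.ofIdx P j) < length b w := by
  obtain ⟨l, rfl, hl'⟩ := exists_isReducedWord b w
  obtain ⟨l', h1, -, h2⟩ := exists_wordProd_eq_mul_ofIdx b l hj h
  have := length_wordProd_le b l'
  rw [h2]
  omega

theorem length_lt_mul_ofIdx {w : P.weylGroup} {j : ι} (hj : b.IsPos j)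
    (h : b.IsPos (w • j)) : length b w < length b (w * weylGroup.ofIdx P j) := by
  have h2 : ¬ b.IsPos ((w * weylGroup.ofIdx P j) • j) := by
    rw [mul_smul, ofIdx_smul_idx, smul_neg, isPos_neg_iff]
    exact not_not.mpr h
  have := length_mul_ofIdx_lt b hj h2
  rwa [mul_assoc, ofIdx_mul_self, mul_one] at this

theorem length_lt_mul_ofIdx_iff {w : P.weylGroup} {j : ι} (hj : b.IsPos j) :
    length b w < length b (w * weylGroup.ofIdx P j) ↔ b.IsPos (w • j) := by
  refine ⟨fun h => ?_, length_lt_mul_ofIdx b hj⟩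
  by_contra h'
  exact lt_asymm h (length_mul_ofIdx_lt b hj h')

theorem length_le_length_mul_simple_add_one (w : P.weylGroup) (k : b.support) :
    length b w ≤ length b (w * simple b k) + 1 := by
  have := length_mul_le b (w * simple b k) (simple b k)
  rw [mul_assoc, simple_mul_self, mul_one] at this
  exact this.trans (Nat.add_le_add_left (length_simple_le b k) _)

theorem length_mul_simple {w : P.weylGroup} {k : b.support} (h : b.IsPos (w • (k : ι))) :
    length b (w * simple b k) = length b w + 1 := by
  have h1 : length b w < length b (w * simple b k) := length_lt_mul_ofIdx b (isPos_simple b k) h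
  have h2 := length_mul_le b w (simple b k)
  have h3 := length_simple_le b k
  omega

theorem length_mul_simple_of_not {w : P.weylGroup} {k : b.support}
    (h : ¬ b.IsPos (w • (k : ι))) : length b (w * simple b k) + 1 = length b w := by
  have h1 : length b (w * simple b k) < length b w := length_mul_ofIdx_lt b (isPos_simple b k) h
  have h2 := length_le_length_mul_simple_add_one b w k
  omega

/-- The last letter of a reduced word is a descent: were its root kept positive, appending it again
would lengthen the word's product. -/
theorem exists_simple_of_ne_one {w : P.weylGroup} (h : w ≠ 1) :
    ∃ k : b.support, ¬ b.IsPos (w • (k : ι)) := by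
  by_contra! hw
  obtain ⟨l, hl, hl'⟩ := exists_isReducedWord b w
  rcases List.eq_nil_or_concat l with rfl | ⟨l, k, rfl⟩
  · exact h (by rw [← hl, wordProd_nil])
  · have h1 := length_mul_simple b (hw k)
    have h2 := length_wordProd_le b l
    rw [List.concat_eq_append, wordProd_append, wordProd_singleton] at hl
    rw [← hl, mul_assoc, simple_mul_self, mul_one] at h1
    rw [hl] at h1
    simp at hl'
    omega

end Length

/-! ### Inversion sets and length-additive products. -/

section Inversions

variable [Finite ι] [P.IsRootSystem] [P.IsCrystallographic] [P.IsReduced] (b : P.Base)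

theorem mem_inversions {w : P.weylGroup} {i : ι} :
    i ∈ inversions b w ↔ b.IsPos i ∧ ¬ b.IsPos (w • i) := Iff.rfl

theorem inversions_one : inversions b (1 : P.weylGroup) = ∅ := by
  ext i; simp [mem_inversions]

/-- If `h⁻¹ i` were negative, its negative would be an inversion of `h` but not of `g * h`. Thus
containment of inversion sets makes the factorization length-additive. -/
theorem isPos_inv_smul_of_subset {g h : P.weylGroup}
    (H : inversions b h ⊆ inversions b (g * h)) {i : ι} (hi : i ∈ inversions b g) :
    b.IsPos (h⁻¹ • i) := by
  by_contra hn
  rw [← isPos_neg_iff] at hn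
  have h1 : P.reflectionPerm (h⁻¹ • i) (h⁻¹ • i) ∈ inversions b h := by
    refine ⟨hn, ?_⟩
    rw [smul_neg, isPos_neg_iff, smul_inv_smul]
    exact not_not.mpr hi.1
  have h2 := (H h1).2
  rw [smul_neg, isPos_neg_iff, mul_smul, smul_inv_smul] at h2
  exact h2 hi.2

theorem inversions_mul {g h : P.weylGroup} (H : ∀ i ∈ inversions b g, b.IsPos (h⁻¹ • i)) :
    inversions b (g * h) = inversions b h ∪ (fun i => h⁻¹ • i) '' inversions b g := by
  ext i
  constructor
  · rintro ⟨h1, h2⟩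
    rw [mul_smul] at h2
    by_cases h3 : b.IsPos (h • i)
    · exact Or.inr ⟨h • i, ⟨h3, h2⟩, inv_smul_smul h i⟩
    · exact Or.inl ⟨h1, h3⟩
  · rintro (⟨h1, h2⟩ | ⟨j, hj, rfl⟩)
    · refine ⟨h1, fun h3 => ?_⟩
      rw [mul_smul] at h3
      rw [← isPos_neg_iff] at h2
      have h4 : P.reflectionPerm (h • i) (h • i) ∈ inversions b g := by
        refine ⟨h2, ?_⟩
        rw [smul_neg, isPos_neg_iff]
        exact not_not.mpr h3
      have := H _ h4
      rw [smul_neg, isPos_neg_iff, inv_smul_smul] at this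
      exact this h1
    · refine ⟨H j hj, ?_⟩
      rw [mul_smul, smul_inv_smul]
      exact hj.2

theorem disjoint_inversions_mul (g h : P.weylGroup) :
    Disjoint (inversions b h) ((fun i => h⁻¹ • i) '' inversions b g) := by
  rw [Set.disjoint_left]
  rintro _ h1 ⟨j, hj, rfl⟩
  refine h1.2 ?_
  rw [smul_inv_smul]
  exact hj.1

theorem inversions_simple (k : b.support) : inversions b (simple b k) = {(k : ι)} := by
  ext i
  constructor
  · rintro ⟨h1, h2⟩
    exact eq_simple_of_simple_smul_not_isPos b h1 h2
  · rintro rfl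
    refine ⟨isPos_simple b k, ?_⟩
    rw [simple_smul_self, isPos_neg_iff]
    exact not_not.mpr (isPos_simple b k)

theorem smul_injective_idx (g : P.weylGroup) : Function.Injective (fun i : ι => g • i) :=
  MulAction.injective g

theorem ncard_inversions_mul {g h : P.weylGroup}
    (H : ∀ i ∈ inversions b g, b.IsPos (h⁻¹ • i)) :
    (inversions b (g * h)).ncard = (inversions b g).ncard + (inversions b h).ncard := by
  rw [inversions_mul b H, Set.ncard_union_eq (disjoint_inversions_mul b g h),
    Set.ncard_image_of_injective _ (smul_injective_idx _), add_comm]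

/-- Splitting off a descent on the right removes exactly one inversion and lowers the length by one.
-/
theorem length_eq_ncard (w : P.weylGroup) : length b w = (inversions b w).ncard := by
  induction hn : length b w generalizing w with
  | zero =>
    rw [eq_one_of_length_eq_zero b hn, inversions_one, Set.ncard_empty]
  | succ n ih =>
    have hw : w ≠ 1 := by
      rintro rfl
      rw [length_one] at hn
      omega
    obtain ⟨k, hk⟩ := exists_simple_of_ne_one b hw
    have h1 := length_mul_simple_of_not b hk
    have h2 := ih (w * simple b k) (by omega)
    have h3 : ∀ i ∈ inversions b (w * simple b k), b.IsPos ((simple b k)⁻¹ • i) := by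
      rintro i ⟨hi, hi'⟩
      rw [simple_inv]
      refine simple_smul_isPos b hi ?_
      rintro rfl
      rw [mul_smul, simple_smul_self, smul_neg, isPos_neg_iff] at hi'
      exact hi' hk
    have h4 := ncard_inversions_mul b h3
    rw [mul_assoc, simple_mul_self, mul_one, inversions_simple, Set.ncard_singleton, ← h2] at h4
    exact h4.symm

theorem length_mul {g h : P.weylGroup} (H : ∀ i ∈ inversions b g, b.IsPos (h⁻¹ • i)) :
    length b (g * h) = length b g + length b h := by
  simp only [length_eq_ncard, ncard_inversions_mul b H]

/-- Containment makes `g = (g h⁻¹) h` length-additive, and equal cardinalities then force `g h⁻¹` to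
have length zero. -/
theorem eq_of_inversions_eq {g h : P.weylGroup} (H : inversions b g = inversions b h) :
    g = h := by
  have h1 : inversions b h ⊆ inversions b ((g * h⁻¹) * h) := by
    rw [inv_mul_cancel_right, H]
  have h2 := length_mul b (fun i hi => isPos_inv_smul_of_subset b h1 hi)
  rw [inv_mul_cancel_right, length_eq_ncard b g, H, ← length_eq_ncard] at h2
  exact mul_inv_eq_one.mp (eq_one_of_length_eq_zero b (by omega))

theorem mem_inversions_inv {g : P.weylGroup} {i : ι} :
    i ∈ inversions b g⁻¹ ↔ P.reflectionPerm (g⁻¹ • i) (g⁻¹ • i) ∈ inversions b g := by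
  rw [mem_inversions, mem_inversions, smul_neg, isPos_neg_iff, isPos_neg_iff, smul_inv_smul,
    not_not, and_comm]

end Inversions

/-! ### Standard parabolic subgroups and their positive roots. -/

section Parabolic

variable [Finite ι] [P.IsRootSystem] [P.IsCrystallographic] [P.IsReduced] (b : P.Base)

/-- The positive roots in the span of the simple roots in `K`. -/
def posRoots (K : Set b.support) : Set ι := {i | b.IsPos i ∧ ∀ k ∉ K, coeff b i k = 0}

variable {b}

theorem simple_mem_posRoots {K : Set b.support} {k : b.support} (hk : k ∈ K) :
    (k : ι) ∈ posRoots b K :=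
  ⟨isPos_simple b k, fun _ hl => coeff_simple_of_ne b (by rintro rfl; exact hl hk)⟩

theorem simple_mem_parabolic {K : Set b.support} {k : b.support} (hk : k ∈ K) :
    simple b k ∈ parabolic b K :=
  Subgroup.subset_closure ⟨k, hk, rfl⟩

theorem parabolic_mono {K L : Set b.support} (h : K ⊆ L) : parabolic b K ≤ parabolic b L :=
  Subgroup.closure_mono (Set.image_mono h)

theorem coeff_smul_of_mem_parabolic {K : Set b.support} {g : P.weylGroup}
    (hg : g ∈ parabolic b K) {k : b.support} (hk : k ∉ K) (i : ι) :
    coeff b (g • i) k = coeff b i k := by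
  induction hg using Subgroup.closure_induction generalizing i with
  | mem x hx =>
    obtain ⟨l, hl, rfl⟩ := hx
    exact coeff_smul_simple b (by rintro rfl; exact hk hl) i
  | one => rw [one_smul]
  | mul x y _ _ hx hy => rw [mul_smul, hx, hy]
  | inv x _ hx => rw [← hx (x⁻¹ • i), smul_inv_smul]

/-- Elements of `W_K` leave the coefficients outside `K` unchanged. For an inversion these are both
nonnegative and nonpositive. -/
theorem inversions_subset_posRoots {K : Set b.support} {g : P.weylGroup}
    (hg : g ∈ parabolic b K) : inversions b g ⊆ posRoots b K := by
  rintro i ⟨h1, h2⟩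
  refine ⟨h1, fun k hk => le_antisymm ?_ (coeff_nonneg b h1 k)⟩
  rw [← coeff_smul_of_mem_parabolic hg hk]
  exact coeff_nonpos b h2 k

theorem isPos_smul_of_notMem_posRoots {K : Set b.support} {g : P.weylGroup}
    (hg : g ∈ parabolic b K) {i : ι} (hi : b.IsPos i) (h : i ∉ posRoots b K) :
    b.IsPos (g • i) := by
  by_contra hn
  exact h (inversions_subset_posRoots hg ⟨hi, hn⟩)

theorem coeff_smul_eq_sum (g : P.weylGroup) (i : ι) (l : b.support) :
    coeff b (g • i) l = ∑ k : b.support, coeff b i k * coeff b (g • (k : ι)) l := by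
  have h : P.root (g • i) = ∑ k : b.support, coeff b i k • P.root (g • (k : ι)) := by
    rw [root_smul]
    conv_lhs => rw [root_eq_sum_coeff b i]
    rw [Finset.smul_sum]
    simp only [root_smul, smul_comm g]
  rw [coeff, h]
  simp [coeff]

theorem isPos_of_forall_coeff_nonneg {i : ι} (h : ∀ k, 0 ≤ coeff b i k) : b.IsPos i := by
  by_contra hi
  apply P.ne_zero i
  rw [root_eq_sum_coeff b i]
  exact Finset.sum_eq_zero fun k _ => by
    rw [le_antisymm (coeff_nonpos b hi k) (h k), zero_smul]

theorem isPos_smul_of_mem_posRoots {K : Set b.support} {g : P.weylGroup} {i : ι}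
    (hi : i ∈ posRoots b K) (h : ∀ k ∈ K, b.IsPos (g • (k : ι))) : b.IsPos (g • i) := by
  refine isPos_of_forall_coeff_nonneg fun l => ?_
  rw [coeff_smul_eq_sum]
  refine Finset.sum_nonneg fun k _ => ?_
  by_cases hk : k ∈ K
  · exact mul_nonneg (coeff_nonneg b hi.1 k) (coeff_nonneg b (h k hk) l)
  · rw [hi.2 k hk, zero_mul]

theorem not_isPos_smul_of_mem_posRoots {K : Set b.support} {g : P.weylGroup} {i : ι}
    (hi : i ∈ posRoots b K) (h : ∀ k ∈ K, ¬ b.IsPos (g • (k : ι))) : ¬ b.IsPos (g • i) := by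
  rw [← isPos_neg_iff]
  refine isPos_of_forall_coeff_nonneg fun l => ?_
  rw [coeff_neg, coeff_smul_eq_sum, ← Finset.sum_neg_distrib]
  refine Finset.sum_nonneg fun k _ => ?_
  by_cases hk : k ∈ K
  · rw [neg_nonneg]
    exact mul_nonpos_of_nonneg_of_nonpos (coeff_nonneg b hi.1 k) (coeff_nonpos b (h k hk) l)
  · rw [hi.2 k hk, zero_mul, neg_zero]

theorem root'_neg (i : ι) (x : N) : P.root' (P.reflectionPerm i i) x = -P.root' i x := by
  rw [root', root_neg, map_neg, LinearMap.neg_apply]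

/-- The roots of `Φ_K` that are negative at a point form the inversion set of an element
of `W_K`. -/
theorem exists_mem_parabolic_inversions_eq (K : Set b.support) (x : N) :
    ∃ g ∈ parabolic b K, inversions b g = {i ∈ posRoots b K | P.root' i x < 0} := by
  induction hn : {i ∈ posRoots b K | P.root' i x < 0}.ncard using Nat.strong_induction_on
    generalizing x with
  | _ n ih =>
    by_cases hK : ∃ k ∈ K, P.root' k x < 0
    -- Reflecting `x` in the wall of `k` removes `k` from the negative set and permutes the other
    -- negative roots, so the cardinality drops by one.
    · obtain ⟨k, hk, hkx⟩ := hK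
      have hval : ∀ i, P.root' i (act (simple b k) x) = P.root' (simple b k • i) x := fun i => by
        rw [root'_act, simple_inv]
      have hk' : ∀ i ∈ {i ∈ posRoots b K | P.root' i (act (simple b k) x) < 0}, i ≠ k := by
        rintro i ⟨-, h⟩ rfl
        rw [hval, simple_smul_self, root'_neg] at h
        linarith
      have hmem : ∀ i ∈ posRoots b K, i ≠ k → simple b k • i ∈ posRoots b K := fun i hi hik =>
        ⟨simple_smul_isPos b hi.1 hik, fun l hl => by
          rw [coeff_smul_of_mem_parabolic (simple_mem_parabolic hk) hl, hi.2 l hl]⟩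
      have hset : {i ∈ posRoots b K | P.root' i x < 0} = {(k : ι)} ∪
          (fun i => simple b k • i) ''
            {i ∈ posRoots b K | P.root' i (act (simple b k) x) < 0} := by
        ext i
        constructor
        · rintro ⟨h1, h2⟩
          by_cases hik : i = k
          · exact Or.inl hik
          · have h3 : simple b k • simple b k • i = i := by
              rw [← mul_smul, simple_mul_self, one_smul]
            refine Or.inr ⟨simple b k • i, ⟨hmem i h1 hik, ?_⟩, h3⟩
            rw [hval, h3]
            exact h2
        · rintro (rfl | ⟨j, hj, rfl⟩)
          · exact ⟨simple_mem_posRoots hk, hkx⟩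
          · refine ⟨hmem j hj.1 (hk' j hj), ?_⟩
            have := hj.2
            rwa [hval] at this
      have hdisj : Disjoint {(k : ι)} ((fun i => simple b k • i) ''
            {i ∈ posRoots b K | P.root' i (act (simple b k) x) < 0}) := by
        rw [Set.disjoint_singleton_left]
        rintro ⟨j, hj, h⟩
        have h1 := (hmem j hj.1 (hk' j hj)).1
        have h2 : simple b k • simple b k • j = P.reflectionPerm k k :=
          congrArg (fun i => simple b k • i) h
        rw [← mul_smul, simple_mul_self, one_smul] at h2
        have h3 := hj.1.1
        rw [h2, isPos_neg_iff] at h3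
        exact h3 (isPos_simple b k)
      have hcard := hn
      rw [hset, Set.ncard_union_eq hdisj, Set.ncard_singleton,
        Set.ncard_image_of_injective _ (smul_injective_idx _)] at hcard
      obtain ⟨g, hg, hg'⟩ := ih _ (by omega) (act (simple b k) x) rfl
      refine ⟨g * simple b k, mul_mem hg (simple_mem_parabolic hk), ?_⟩
      rw [inversions_mul b, inversions_simple, hset, hg', simple_inv]
      intro i hi
      rw [simple_inv]
      rw [hg'] at hi
      exact simple_smul_isPos b hi.1.1 (hk' i hi)
    -- No simple root of `K` is negative at `x`, hence no positive root of `Φ_K` is.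
    · push Not at hK
      refine ⟨1, one_mem _, ?_⟩
      rw [inversions_one, eq_comm, Set.eq_empty_iff_forall_notMem]
      rintro i ⟨h1, h2⟩
      rw [root'_eq_sum_coeff b] at h2
      refine absurd h2 (not_lt.mpr (Finset.sum_nonneg fun k _ => ?_))
      by_cases hk : k ∈ K
      · exact mul_nonneg (coeff_nonneg b h1.1 k) (hK k hk)
      · rw [h1.2 k hk, zero_mul]

theorem exists_longest (K : Set b.support) :
    ∃ h ∈ parabolic b K, inversions b h = posRoots b K := by
  obtain ⟨x, hx⟩ := exists_dominant b
  obtain ⟨h, h1, h2⟩ := exists_mem_parabolic_inversions_eq K (-x)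
  refine ⟨h, h1, h2.trans ?_⟩
  ext i
  simp only [Set.mem_ofPred_eq, map_neg, neg_lt_zero, and_iff_left_iff_imp]
  exact fun hi => (hx i).mp hi.1

/-- Inversion sets in `W_K` lie in `posRoots b K`, and an element attaining all of it exists;
maximal length therefore means maximal inversion set. -/
theorem inversions_of_isLongest {K : Set b.support} {g : P.weylGroup} (hg : IsLongest b K g) :
    inversions b g = posRoots b K := by
  obtain ⟨h, h1, h2⟩ := exists_longest K
  refine Set.eq_of_subset_of_ncard_le (inversions_subset_posRoots hg.1) ?_
  rw [← h2, ← length_eq_ncard, ← length_eq_ncard]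
  exact hg.2 h h1

theorem isPos_smul_longest {K : Set b.support} {h : P.weylGroup}
    (hh : inversions b h = posRoots b K) {i : ι} (hi : ∀ k ∉ K, coeff b i k = 0) :
    b.IsPos (h • i) ↔ ¬ b.IsPos i := by
  by_cases h1 : b.IsPos i
  · have h2 : i ∈ inversions b h := hh ▸ ⟨h1, hi⟩
    exact iff_of_false h2.2 (not_not.mpr h1)
  · have h2 : P.reflectionPerm i i ∈ inversions b h := by
      rw [hh]
      refine ⟨(isPos_neg_iff b i).mpr h1, fun k hk => ?_⟩
      rw [coeff_neg, hi k hk, neg_zero]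
    have h3 := h2.2
    rw [smul_neg, isPos_neg_iff, not_not] at h3
    exact iff_of_true h3 h1

end Parabolic

/-! ### Interpolation in the weak order and amalgamation of chambers. -/

section WeakOrder

variable [Finite ι] [P.IsRootSystem] [P.IsCrystallographic] [P.IsReduced] {b : P.Base}

/-- Any descent `k` of `a z⁻¹` works: `s_k z` then covers `z` in the weak order and stays below `a`.
-/
theorem exists_cover_of_inversions_subset {z a : P.weylGroup}
    (h : inversions b z ⊆ inversions b a) (hne : z ≠ a) :
    ∃ k : b.support, b.IsPos (z⁻¹ • (k : ι)) ∧ z⁻¹ • (k : ι) ∈ inversions b a := by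
  have h1 : inversions b z ⊆ inversions b ((a * z⁻¹) * z) := by rwa [inv_mul_cancel_right]
  have h2 : a * z⁻¹ ≠ 1 := fun h => hne (mul_inv_eq_one.mp h).symm
  obtain ⟨k, hk⟩ := exists_simple_of_ne_one b h2
  have h3 := isPos_inv_smul_of_subset b h1 ⟨isPos_simple b k, hk⟩
  refine ⟨k, h3, h3, ?_⟩
  rwa [mul_smul] at hk

theorem inversions_simple_mul {z : P.weylGroup} {k : b.support}
    (h : b.IsPos (z⁻¹ • (k : ι))) :
    inversions b (simple b k * z) = insert (z⁻¹ • (k : ι)) (inversions b z) := by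
  have H : ∀ i ∈ inversions b (simple b k), b.IsPos (z⁻¹ • i) := by
    rw [inversions_simple]
    rintro _ rfl
    exact h
  rw [inversions_mul b H, inversions_simple, Set.image_singleton, Set.union_singleton]

/-- Interpolation in the weak order: two elements below two others are separated from them. -/
theorem exists_inversions_between {a d m m' : P.weylGroup}
    (ham : inversions b a ⊆ inversions b m) (ham' : inversions b a ⊆ inversions b m')
    (hdm : inversions b d ⊆ inversions b m) (hdm' : inversions b d ⊆ inversions b m') :
    ∃ w, inversions b a ⊆ inversions b w ∧ inversions b d ⊆ inversions b w ∧
      inversions b w ⊆ inversions b m ∧ inversions b w ⊆ inversions b m' := by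
  -- Induct on the gap between `m` and a common lower bound `z` of `a` and `d`, keeping `m` and `m'`
  -- fixed.
  suffices key : ∀ (n : ℕ) (z a d : P.weylGroup), (inversions b m).ncard ≤ length b z + n →
      inversions b z ⊆ inversions b a → inversions b z ⊆ inversions b d →
      inversions b a ⊆ inversions b m → inversions b a ⊆ inversions b m' →
      inversions b d ⊆ inversions b m → inversions b d ⊆ inversions b m' →
      ∃ w, inversions b a ⊆ inversions b w ∧ inversions b d ⊆ inversions b w ∧
        inversions b w ⊆ inversions b m ∧ inversions b w ⊆ inversions b m' by
    refine key _ 1 a d (Nat.le_add_left _ _) ?_ ?_ ham ham' hdm hdm' <;>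
    · rw [inversions_one]
      exact Set.empty_subset _
  intro n
  induction n with
  | zero =>
    intro z a d hn hza hzd ham ham' hdm hdm'
    have h : inversions b z = inversions b m := by
      refine Set.eq_of_subset_of_ncard_le (hza.trans ham) ?_
      rw [← length_eq_ncard b z]
      exact hn
    exact ⟨d, ham.trans (h ▸ hzd), subset_rfl, hdm, hdm'⟩
  | succ n ih =>
    intro z a d hn hza hzd ham ham' hdm hdm'
    by_cases ha : z = a
    · exact ⟨d, ha ▸ hzd, subset_rfl, hdm, hdm'⟩
    by_cases hd : z = d
    · exact ⟨a, subset_rfl, hd ▸ hza, ham, ham'⟩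
    obtain ⟨k, hk, hka⟩ := exists_cover_of_inversions_subset hza ha
    obtain ⟨l, hl, hld⟩ := exists_cover_of_inversions_subset hzd hd
    have hlen : ∀ k : b.support, b.IsPos (z⁻¹ • (k : ι)) →
        (inversions b m).ncard ≤ length b (simple b k * z) + n := fun k hk => by
      have hnot : z⁻¹ • (k : ι) ∉ inversions b z := fun h => h.2 (by
        rw [smul_inv_smul]; exact isPos_simple b k)
      rw [length_eq_ncard b (simple b k * z), inversions_simple_mul hk,
        Set.ncard_insert_of_notMem hnot, ← length_eq_ncard b z]
      omega
    by_cases hkl : k = l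
    · subst hkl
      refine ih (simple b k * z) a d (hlen k hk) ?_ ?_ ham ham' hdm hdm' <;>
        rw [inversions_simple_mul hk]
      · exact Set.insert_subset hka hza
      · exact Set.insert_subset hld hzd
    -- With `h` longest in the rank two subgroup of `k` and `l`, the element `h z` lies above both
    -- covers `s_k z` and `s_l z`, and below anything above `z` that inverts both new roots, in
    -- particular `m` and `m'`.
    · obtain ⟨h, -, hh⟩ := exists_longest (b := b) {k, l}
      have hpos : ∀ i ∈ inversions b h, b.IsPos (z⁻¹ • i) := by
        rw [hh]
        refine fun i hi => isPos_smul_of_mem_posRoots hi ?_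
        rintro _ (rfl | rfl)
        exacts [hk, hl]
      have hj := inversions_mul b hpos
      have hle : ∀ m, inversions b z ⊆ inversions b m → z⁻¹ • (k : ι) ∈ inversions b m →
          z⁻¹ • (l : ι) ∈ inversions b m → inversions b (h * z) ⊆ inversions b m := by
        intro m hz hkm hlm
        rw [hj]
        refine Set.union_subset hz ?_
        rintro _ ⟨i, hi, rfl⟩
        refine ⟨hpos i hi, ?_⟩
        rw [hh] at hi
        dsimp only
        rw [← mul_smul]
        refine not_isPos_smul_of_mem_posRoots hi ?_
        rintro _ (rfl | rfl)
        · rw [mul_smul]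
          exact hkm.2
        · rw [mul_smul]
          exact hlm.2
      have hmemj : ∀ k' ∈ ({k, l} : Set b.support),
          insert (z⁻¹ • (k' : ι)) (inversions b z) ⊆ inversions b (h * z) := by
        intro k' hk'
        rw [hj]
        refine Set.insert_subset (Or.inr ⟨k', ?_, rfl⟩) Set.subset_union_left
        rw [hh]
        exact simple_mem_posRoots hk'
      -- Interpolate `a` and `h z` over `s_k z`; the result lies above `s_l z`, so it can then be
      -- interpolated with `d` over `s_l z`.
      obtain ⟨w₁, h1, h2, h3, h4⟩ := ih (simple b k * z) a (h * z) (hlen k hk)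
        (by rw [inversions_simple_mul hk]; exact Set.insert_subset hka hza)
        (by rw [inversions_simple_mul hk]; exact hmemj k (Or.inl rfl))
        ham ham' (hle m (hza.trans ham) (ham hka) (hdm hld))
        (hle m' (hza.trans ham') (ham' hka) (hdm' hld))
      obtain ⟨w₂, h5, h6, h7, h8⟩ := ih (simple b l * z) w₁ d (hlen l hl)
        (by rw [inversions_simple_mul hl]; exact (hmemj l (Or.inr rfl)).trans h2)
        (by rw [inversions_simple_mul hl]; exact Set.insert_subset hld hzd)
        h3 h4 hdm hdm'
      exact ⟨w₂, h1.trans h5, h6, h7, h8⟩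

/-- The largest inversion set agreeing with that of `a` on `Φ_I`. Multiplying `a` by the longest
element of `W_I` reverses the signs on `Φ_I` and keeps the remaining positive roots positive; the
longest element of `W` then reverses every sign. -/
theorem exists_inversions_eq_union {I : Set b.support} {a : P.weylGroup}
    (ha : a ∈ parabolic b I) : ∃ m : P.weylGroup,
      inversions b m = {i | b.IsPos i ∧ (i ∈ posRoots b I → i ∈ inversions b a)} := by
  obtain ⟨h, h1, h2⟩ := exists_longest I
  obtain ⟨w, -, h3⟩ := exists_longest (b := b) Set.univ
  refine ⟨w * h * a, ?_⟩
  ext i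
  simp only [mem_inversions, Set.mem_ofPred_eq, mul_smul]
  refine and_congr_right fun hi => ?_
  rw [isPos_smul_longest h3 (fun k hk => absurd (Set.mem_univ k) hk), not_not]
  by_cases hI : i ∈ posRoots b I
  · rw [isPos_smul_longest h2 (fun k hk => by
      rw [coeff_smul_of_mem_parabolic ha hk, hI.2 k hk])]
    simp [hI, hi]
  · rw [← mul_smul]
    exact iff_of_true (isPos_smul_of_notMem_posRoots (mul_mem h1 ha) hi hI) fun h => absurd h hI

/-- Chambers of two standard parabolic subsystems that agree on the intersection have a
common refinement. -/
theorem exists_amalgam (I J : Set b.support) (x y : N)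
    (H : ∀ i ∈ posRoots b (I ∩ J), P.root' i x < 0 ↔ P.root' i y < 0) :
    ∃ z : N, (∀ i, P.root' i z ≠ 0) ∧
      (∀ i ∈ posRoots b I, P.root' i z < 0 ↔ P.root' i x < 0) ∧
      (∀ i ∈ posRoots b J, P.root' i z < 0 ↔ P.root' i y < 0) := by
  obtain ⟨a, ha, hax⟩ := exists_mem_parabolic_inversions_eq I x
  obtain ⟨d, hd, hdy⟩ := exists_mem_parabolic_inversions_eq J y
  obtain ⟨m, hm⟩ := exists_inversions_eq_union ha
  obtain ⟨m', hm'⟩ := exists_inversions_eq_union hd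
  have hinter : ∀ i, i ∈ posRoots b I → i ∈ posRoots b J → i ∈ posRoots b (I ∩ J) := by
    intro i h1 h2
    refine ⟨h1.1, fun k hk => ?_⟩
    by_cases hkI : k ∈ I
    · exact h2.2 k fun hkJ => hk ⟨hkI, hkJ⟩
    · exact h1.2 k hkI
  -- An element between `{a, d}` and `{m, m'}` restricts to `a` on `Φ_I` and to `d` on `Φ_J`. The
  -- mixed inclusions, `a` below `m'` and `d` below `m`, are where agreement on `I ∩ J` enters.
  obtain ⟨w, h1, h2, h3, h4⟩ := exists_inversions_between (a := a) (d := d) (m := m) (m' := m')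
    (by rw [hm]; exact fun i hi => ⟨hi.1, fun _ => hi⟩)
    (by
      rw [hm']
      refine fun i hi => ⟨hi.1, fun hJ => ?_⟩
      rw [hax] at hi
      rw [hdy]
      exact ⟨hJ, (H i (hinter i hi.1 hJ)).mp hi.2⟩)
    (by
      rw [hm]
      refine fun i hi => ⟨hi.1, fun hI => ?_⟩
      rw [hdy] at hi
      rw [hax]
      exact ⟨hI, (H i (hinter i hI hi.1)).mpr hi.2⟩)
    (by rw [hm']; exact fun i hi => ⟨hi.1, fun _ => hi⟩)
  obtain ⟨ρ, hρ⟩ := exists_dominant b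
  have hval : ∀ i, P.root' i (act w⁻¹ ρ) = P.root' (w • i) ρ := fun i => by
    rw [root'_act, inv_inv]
  have hne : ∀ i, P.root' i ρ ≠ 0 := fun i h => by
    by_cases hi : b.IsPos i
    · exact ((hρ i).mp hi).ne' h
    · rw [← isPos_neg_iff, hρ, root'_neg, h, neg_zero] at hi
      exact lt_irrefl _ hi
  have hneg : ∀ i, b.IsPos i → (P.root' i (act w⁻¹ ρ) < 0 ↔ i ∈ inversions b w) := by
    intro i hi
    rw [hval, mem_inversions, hρ (w • i), not_lt]
    exact ⟨fun h => ⟨hi, h.le⟩, fun h => lt_of_le_of_ne h.2 (hne _)⟩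
  refine ⟨act w⁻¹ ρ, fun i => hval i ▸ hne _, fun i hi => ?_, fun i hi => ?_⟩
  · rw [hneg i hi.1]
    constructor
    · intro h
      have := h3 h
      rw [hm] at this
      have := this.2 hi
      rw [hax] at this
      exact this.2
    · intro h
      exact h1 (hax ▸ ⟨hi, h⟩)
  · rw [hneg i hi.1]
    constructor
    · intro h
      have := h4 h
      rw [hm'] at this
      have := this.2 hi
      rw [hdy] at this
      exact this.2
    · intro h
      exact h2 (hdy ▸ ⟨hi, h⟩)

end WeakOrder

/-! ### The strong Bruhat order. -/

section Bruhat

variable [Finite ι] [P.IsRootSystem] [P.IsCrystallographic] [P.IsReduced] {b : P.Base}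

theorem exists_isPos_of_mem_reflections {t : P.weylGroup} (ht : t ∈ reflections b) :
    ∃ j, b.IsPos j ∧ t = weylGroup.ofIdx P j := by
  obtain ⟨g, k, rfl⟩ := ht
  rw [show simple b k = weylGroup.ofIdx P (k : ι) from rfl, ← ofIdx_smul_eq]
  by_cases h : b.IsPos (g • (k : ι))
  · exact ⟨_, h, rfl⟩
  · exact ⟨_, (isPos_neg_iff b _).mpr h, (ofIdx_neg _).symm⟩

theorem simple_mem_reflections (k : b.support) : simple b k ∈ reflections b :=
  ⟨1, k, by simp⟩

theorem conj_mem_reflections {t : P.weylGroup} (ht : t ∈ reflections b) (g : P.weylGroup) :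
    g * t * g⁻¹ ∈ reflections b := by
  obtain ⟨h, k, rfl⟩ := ht
  exact ⟨g * h, k, by group⟩

theorem BruhatLE.refl (x : P.weylGroup) : BruhatLE b x x := Relation.ReflTransGen.refl

theorem BruhatLE.trans {x y z : P.weylGroup} (h : BruhatLE b x y) (h' : BruhatLE b y z) :
    BruhatLE b x z := Relation.ReflTransGen.trans h h'

theorem BruhatLE.mul_of_lt {x t : P.weylGroup} (ht : t ∈ reflections b)
    (h : length b x < length b (x * t)) : BruhatLE b x (x * t) :=
  Relation.ReflTransGen.single ⟨t, ht, rfl, h⟩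

theorem BruhatLE.length_le {x y : P.weylGroup} (h : BruhatLE b x y) :
    length b x ≤ length b y := by
  induction h with
  | refl => exact le_rfl
  | tail _ h ih =>
    obtain ⟨t, -, -, h⟩ := h
    exact ih.trans h.le

theorem BruhatLE.inv {x y : P.weylGroup} (h : BruhatLE b x y) : BruhatLE b x⁻¹ y⁻¹ := by
  induction h with
  | refl => exact BruhatLE.refl _
  | @tail y z _ h ih =>
    obtain ⟨t, ht, rfl, h⟩ := h
    obtain ⟨j, -, hj⟩ := exists_isPos_of_mem_reflections ht
    have e : (y * t)⁻¹ = y⁻¹ * (y * t * y⁻¹) := by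
      have : t⁻¹ = t := by rw [hj, ofIdx_inv]
      rw [mul_inv_rev, this]
      group
    refine ih.trans ?_
    rw [← length_inv, ← length_inv b (y * t), e] at h
    rw [e]
    exact BruhatLE.mul_of_lt (conj_mem_reflections ht y) h

/-- The lifting property of the Bruhat order. -/
theorem BruhatLE.mul_simple {x y : P.weylGroup} (h : BruhatLE b x y) (k : b.support) :
    BruhatLE b (x * simple b k) (y * simple b k) ∨
      (BruhatLE b x (y * simple b k) ∧ BruhatLE b (x * simple b k) y) := by
  induction h with
  | refl => exact Or.inl (BruhatLE.refl _)
  | @tail z y _ h ih =>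
    obtain ⟨t, ht, rfl, hlt⟩ := h
    have hzy : BruhatLE b z (z * t) := BruhatLE.mul_of_lt ht hlt
    obtain ⟨j, hj, rfl⟩ := exists_isPos_of_mem_reflections ht
    by_cases hjk : j = k
    · subst hjk
      change _ ∨ _ ∧ _
      rw [show weylGroup.ofIdx P (k : ι) = simple b k from rfl, mul_assoc, simple_mul_self,
        mul_one] at *
      rcases ih with ih | ih
      · exact Or.inr ⟨‹_›, ih⟩
      · exact Or.inr ⟨‹_›, BruhatLE.trans ih.2 hzy⟩
    -- Since `s_k` keeps every positive root other than `k` positive, the step from `z` to `z t` is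
    -- still ascending after right multiplication by `s_k`.
    · have h1 : z * weylGroup.ofIdx P j * simple b k =
          z * simple b k * weylGroup.ofIdx P (simple b k • j) := by
        rw [ofIdx_smul_eq]
        have := simple_mul_self b k
        rw [simple_inv, ← mul_assoc, ← mul_assoc, mul_assoc z (simple b k), this, mul_one]
      have h2 : BruhatLE b (z * simple b k) (z * weylGroup.ofIdx P j * simple b k) := by
        rw [h1]
        refine BruhatLE.mul_of_lt ?_ ?_
        · rw [ofIdx_smul_eq]
          exact conj_mem_reflections ht _
        · refine length_lt_mul_ofIdx b (simple_smul_isPos b hj hjk) ?_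
          rw [← mul_smul, mul_assoc, simple_mul_self, mul_one]
          exact (length_lt_mul_ofIdx_iff b hj).mp hlt
      rcases ih with ih | ih
      · exact Or.inl (BruhatLE.trans ih h2)
      · exact Or.inr ⟨BruhatLE.trans ih.1 h2, BruhatLE.trans ih.2 hzy⟩

theorem BruhatLE.mul_simple_of_lt {w : P.weylGroup} {k : b.support}
    (h : length b w < length b (w * simple b k)) : BruhatLE b w (w * simple b k) :=
  BruhatLE.mul_of_lt (simple_mem_reflections k) h

theorem BruhatLE.one_le (w : P.weylGroup) : BruhatLE b 1 w := by
  induction hn : length b w generalizing w with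
  | zero => rw [eq_one_of_length_eq_zero b hn]; exact BruhatLE.refl _
  | succ n ih =>
    have hw : w ≠ 1 := by
      rintro rfl
      rw [length_one] at hn
      omega
    obtain ⟨k, hk⟩ := exists_simple_of_ne_one b hw
    have h1 := length_mul_simple_of_not b hk
    refine (ih (w * simple b k) (by omega)).trans ?_
    have h2 := BruhatLE.mul_simple_of_lt (b := b) (w := w * simple b k) (k := k)
    rw [mul_assoc, simple_mul_self, mul_one] at h2
    exact h2 (by omega)

/-- Peel the last letter off `v`, apply the lifting property to `y ≤ v`, and lift back to the
product. Additivity of lengths keeps the shortened product below `u * v`. -/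
theorem BruhatLE.mul {u v x y : P.weylGroup} (hx : BruhatLE b x u) (hy : BruhatLE b y v)
    (h : length b (u * v) = length b u + length b v) : BruhatLE b (x * y) (u * v) := by
  induction hn : length b v generalizing v y with
  | zero =>
    have hv := eq_one_of_length_eq_zero b hn
    have hy' := hy.length_le
    have hy'' := eq_one_of_length_eq_zero b (w := y) (by omega)
    rwa [hv, hy'', mul_one, mul_one]
  | succ n ih =>
    have hv : v ≠ 1 := by
      rintro rfl
      rw [length_one] at hn
      omega
    obtain ⟨k, hk⟩ := exists_simple_of_ne_one b hv
    have h1 := length_mul_simple_of_not b hk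
    have hv' : v * simple b k * simple b k = v := by
      rw [mul_assoc, simple_mul_self, mul_one]
    have h2 := length_mul_le b u (v * simple b k)
    have h3 := length_le_length_mul_simple_add_one b (u * v) k
    rw [mul_assoc] at h3
    have h4 : length b (u * (v * simple b k)) = length b u + length b (v * simple b k) := by
      omega
    have huv : u * (v * simple b k) * simple b k = u * v := by
      rw [mul_assoc, hv']
    have h5 : BruhatLE b (u * (v * simple b k)) (u * v) := by
      rw [← huv]
      refine BruhatLE.mul_simple_of_lt ?_
      rw [huv]
      omega
    rcases hy.mul_simple k with hy' | hy'
    · have h6 := ih hy' h4 (by omega)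
      rcases h6.mul_simple k with h7 | h7
      · rwa [huv, mul_assoc, mul_assoc, simple_mul_self, mul_one] at h7
      · have h8 := h7.2
        rw [mul_assoc, mul_assoc, simple_mul_self, mul_one] at h8
        exact h8.trans h5
    · exact (ih hy'.1 h4 (by omega)).trans h5

theorem exists_wordProd_of_mem_parabolic {K : Set b.support} {w : P.weylGroup}
    (hw : w ∈ parabolic b K) : ∃ l : List b.support, (∀ k ∈ l, k ∈ K) ∧ wordProd b l = w := by
  induction hw using Subgroup.closure_induction with
  | mem x hx =>
    obtain ⟨k, hk, rfl⟩ := hx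
    exact ⟨[k], by simpa using hk, wordProd_singleton b k⟩
  | one => exact ⟨[], by simp, rfl⟩
  | mul x y _ _ hx hy =>
    obtain ⟨l, h1, h2⟩ := hx
    obtain ⟨m, h3, h4⟩ := hy
    refine ⟨l ++ m, fun k hk => ?_, by rw [wordProd_append, h2, h4]⟩
    exact (List.mem_append.mp hk).elim (h1 k) (h3 k)
  | inv x _ hx =>
    obtain ⟨l, h1, h2⟩ := hx
    exact ⟨l.reverse, fun k hk => h1 k (List.mem_reverse.mp hk), by rw [wordProd_reverse, h2]⟩

theorem wordProd_mem_parabolic {K : Set b.support} {l : List b.support}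
    (h : ∀ k ∈ l, k ∈ K) : wordProd b l ∈ parabolic b K := by
  refine list_prod_mem fun x hx => ?_
  obtain ⟨k, hk, rfl⟩ := List.mem_map.mp hx
  exact simple_mem_parabolic (h k hk)

theorem BruhatLE.mem_parabolic {K : Set b.support} {x y : P.weylGroup} (h : BruhatLE b x y)
    (hy : y ∈ parabolic b K) : x ∈ parabolic b K := by
  obtain ⟨l, hl, rfl⟩ := exists_wordProd_of_mem_parabolic hy
  clear hy
  induction l using List.reverseRecOn generalizing x with
  | nil =>
    have := h.length_le
    rw [wordProd_nil, length_one] at this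
    rw [eq_one_of_length_eq_zero b (w := x) (by omega)]
    exact one_mem _
  | append_singleton l k ih =>
    have hl' : ∀ k ∈ l, k ∈ K := fun k hk => hl k (by simp [hk])
    have hk : k ∈ K := hl k (by simp)
    have h1 := h.mul_simple k
    rw [wordProd_append, wordProd_singleton, mul_assoc, simple_mul_self, mul_one] at h1
    rcases h1 with h1 | h1
    · have h2 := mul_mem (ih hl' h1) (simple_mem_parabolic hk)
      rwa [mul_assoc, simple_mul_self, mul_one] at h2
    · exact ih hl' h1.1

theorem mem_parabolic_wordSupport (w : P.weylGroup) : w ∈ parabolic b (wordSupport b w) := by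
  obtain ⟨l, hl⟩ := exists_isReducedWord b w
  rw [← hl.1]
  exact wordProd_mem_parabolic fun k hk => ⟨l, hl.1 ▸ hl, hk⟩

/-- Cutting a reduced word at the letter gives a length-additive product of three factors, in which
the outer two can be replaced by `1`. -/
theorem simple_bruhatLE_of_mem_wordSupport {w : P.weylGroup} {k : b.support}
    (hk : k ∈ wordSupport b w) : BruhatLE b (simple b k) w := by
  obtain ⟨l, ⟨rfl, hl⟩, hkl⟩ := hk
  obtain ⟨l₁, l₂, rfl⟩ := List.append_of_mem hkl
  have e : wordProd b (l₁ ++ k :: l₂) = wordProd b l₁ * (simple b k * wordProd b l₂) := by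
    rw [wordProd_append, wordProd_cons]
  rw [e] at hl ⊢
  rw [List.length_append, List.length_cons] at hl
  have h1 := length_mul_le b (wordProd b l₁) (simple b k * wordProd b l₂)
  have h2 := length_mul_le b (simple b k) (wordProd b l₂)
  have h3 := length_wordProd_le b l₁
  have h4 := length_wordProd_le b l₂
  have h5 := length_simple_le b k
  have h6 : BruhatLE b (simple b k * 1) (simple b k * wordProd b l₂) :=
    (BruhatLE.refl _).mul (BruhatLE.one_le _) (by omega)
  have h7 := (BruhatLE.one_le (wordProd b l₁)).mul h6 (by omega)
  rwa [one_mul, mul_one] at h7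

theorem exists_point (w : P.weylGroup) : ∃ z : N, ∀ i, 0 < P.root' i z ↔ b.IsPos (w • i) := by
  obtain ⟨ρ, hρ⟩ := exists_dominant b
  exact ⟨act w⁻¹ ρ, fun i => by rw [root'_act, inv_inv, hρ]⟩

/-- At a point of the chamber of `w`, the negative roots of `Φ_K` are all the inversions of `w`;
some element of `W_K` has that inversion set and must be `w`. -/
theorem mem_parabolic_of_inversions_subset {K : Set b.support} {w : P.weylGroup}
    (h : inversions b w ⊆ posRoots b K) : w ∈ parabolic b K := by
  obtain ⟨z, hz⟩ := exists_point (b := b) w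
  obtain ⟨g, hg, hg'⟩ := exists_mem_parabolic_inversions_eq K z
  have : inversions b g = inversions b w := by
    rw [hg']
    ext i
    have e : P.root' i z < 0 ↔ b.IsPos (w • P.reflectionPerm i i) := by
      rw [← hz, root'_neg, neg_pos]
    rw [smul_neg, isPos_neg_iff] at e
    exact ⟨fun hi => ⟨hi.1.1, e.mp hi.2⟩, fun hi => ⟨h hi, e.mpr hi.2⟩⟩
  rwa [← eq_of_inversions_eq b this]

theorem mem_parabolic_inter {I J : Set b.support} {w : P.weylGroup} (hI : w ∈ parabolic b I)
    (hJ : w ∈ parabolic b J) : w ∈ parabolic b (I ∩ J) := by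
  refine mem_parabolic_of_inversions_subset fun i hi => ⟨hi.1, fun k hk => ?_⟩
  by_cases hkI : k ∈ I
  · exact (inversions_subset_posRoots hJ hi).2 k fun hkJ => hk ⟨hkI, hkJ⟩
  · exact (inversions_subset_posRoots hI hi).2 k hkI

/-- Climb from `x` by ascents in `K`. When none is left, every positive root of `Φ_K` is inverted,
so the longest element has been reached. -/
theorem BruhatLE.of_isLongest {K : Set b.support} {w x : P.weylGroup} (hw : IsLongest b K w)
    (hx : x ∈ parabolic b K) : BruhatLE b x w := by
  induction hn : length b w - length b x using Nat.strong_induction_on generalizing x with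
  | _ n ih =>
    by_cases h : ∃ k ∈ K, b.IsPos (x • (k : ι))
    · obtain ⟨k, hk, hkx⟩ := h
      have h1 := length_mul_simple b hkx
      have h2 := mul_mem hx (simple_mem_parabolic hk)
      have h3 := hw.2 _ h2
      exact (BruhatLE.mul_simple_of_lt (by omega)).trans (ih _ (by omega) h2 rfl)
    · push Not at h
      have h1 : inversions b x = inversions b w := by
        rw [inversions_of_isLongest hw]
        refine (inversions_subset_posRoots hx).antisymm fun i hi => ⟨hi.1, ?_⟩
        exact not_isPos_smul_of_mem_posRoots hi h
      rw [eq_of_inversions_eq b h1]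
      exact BruhatLE.refl _

end Bruhat

/-! ### Minimal coset representatives and factorization of Poincaré polynomials. -/

section MinCosetReps

variable [Finite ι] [P.IsRootSystem] [P.IsCrystallographic] [P.IsReduced] {b : P.Base}

theorem isPos_inv_smul_of_mem_minCosetReps {J : Set b.support} {v : P.weylGroup}
    (hv : v ∈ minCosetReps b J) {i : ι} (hi : i ∈ posRoots b J) : b.IsPos (v⁻¹ • i) := by
  refine isPos_smul_of_mem_posRoots hi fun k hk => ?_
  by_contra h
  have h1 := length_mul_simple_of_not b h
  have h2 := hv (simple b k) (simple_mem_parabolic hk)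
  rw [← length_inv b (simple b k * v), mul_inv_rev, simple_inv, ← length_inv b v] at h2
  omega

theorem isPos_inv_smul_of_mem_inversions {J : Set b.support} {u v : P.weylGroup}
    (hu : u ∈ parabolic b J) (hv : v ∈ minCosetReps b J) :
    ∀ i ∈ inversions b u, b.IsPos (v⁻¹ • i) := fun _ hi =>
  isPos_inv_smul_of_mem_minCosetReps hv (inversions_subset_posRoots hu hi)

theorem length_mul_of_mem_minCosetReps {J : Set b.support} {u v : P.weylGroup}
    (hu : u ∈ parabolic b J) (hv : v ∈ minCosetReps b J) :
    length b (u * v) = length b u + length b v :=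
  length_mul b (isPos_inv_smul_of_mem_inversions hu hv)

variable (b) in
theorem exists_eq_mul_minCosetReps (J : Set b.support) (w : P.weylGroup) :
    ∃ a ∈ parabolic b J, ∃ c ∈ minCosetReps b J, w = a * c := by
  let s : Set P.weylGroup := {c | ∃ a ∈ parabolic b J, w = a * c}
  have hs : s.Nonempty := ⟨w, 1, one_mem _, (one_mul w).symm⟩
  obtain ⟨a, ha, hac⟩ := Function.argminOn_mem (length b) s hs
  refine ⟨a, ha, Function.argminOn (length b) s hs, fun x hx => Function.argminOn_le (length b) s
    ⟨a * x⁻¹, mul_mem ha (inv_mem hx), ?_⟩, hac⟩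
  rw [mul_assoc, inv_mul_cancel_left]
  exact hac

theorem eq_of_mul_minCosetReps_eq {J : Set b.support} {a a' c c' : P.weylGroup}
    (ha : a ∈ parabolic b J) (ha' : a' ∈ parabolic b J) (hc : c ∈ minCosetReps b J)
    (hc' : c' ∈ minCosetReps b J) (h : a * c = a' * c') : a = a' ∧ c = c' := by
  have hx := mul_mem (inv_mem ha') ha
  have h1 : c' = (a'⁻¹ * a) * c := by rw [mul_assoc, h, inv_mul_cancel_left]
  have h2 := length_mul_of_mem_minCosetReps hx hc
  have h3 := hc' _ (inv_mem hx)
  rw [h1, inv_mul_cancel_left, h2] at h3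
  have h4 := eq_one_of_length_eq_zero b (w := a'⁻¹ * a) (by omega)
  rw [h4, one_mul] at h1
  exact ⟨(inv_mul_eq_one.mp h4).symm, h1.symm⟩

theorem simple_mem_of_mem_posRoots {K : Set b.support} {k : b.support}
    (h : (k : ι) ∈ posRoots b K) : k ∈ K := by
  by_contra hk
  have := h.2 k hk
  rw [coeff_simple_self] at this
  exact one_ne_zero this

theorem BruhatLE.simple_mul {x y : P.weylGroup} (h : BruhatLE b x y) (k : b.support) :
    BruhatLE b (simple b k * x) (simple b k * y) ∨
      (BruhatLE b x (simple b k * y) ∧ BruhatLE b (simple b k * x) y) := by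
  have h1 := h.inv.mul_simple k
  have e : ∀ z : P.weylGroup, (z⁻¹ * simple b k)⁻¹ = simple b k * z := fun z => by
    rw [mul_inv_rev, inv_inv, simple_inv]
  rcases h1 with h1 | ⟨h1, h2⟩
  · left
    have := h1.inv
    rwa [e, e] at this
  · right
    have h1 := h1.inv
    have h2 := h2.inv
    rw [e, inv_inv] at h1 h2
    exact ⟨h1, h2⟩

/-- The projection to minimal coset representatives is monotone for the Bruhat order. -/
theorem BruhatLE.of_mul_minCosetReps {J : Set b.support} {a a' c c' : P.weylGroup}
    (ha : a ∈ parabolic b J) (ha' : a' ∈ parabolic b J) (hc : c ∈ minCosetReps b J)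
    (h : BruhatLE b (a * c) (a' * c')) : BruhatLE b c c' := by
  induction hn : length b a' generalizing a a' with
  | zero =>
    rw [eq_one_of_length_eq_zero b hn, one_mul] at h
    have h1 := (BruhatLE.one_le a).mul (BruhatLE.refl c) (length_mul_of_mem_minCosetReps ha hc)
    rw [one_mul] at h1
    exact h1.trans h
  | succ n ih =>
    have h1 : a'⁻¹ ≠ 1 := by
      intro h1
      rw [inv_eq_one.mp h1, length_one] at hn
      omega
    obtain ⟨k, hk⟩ := exists_simple_of_ne_one b h1
    have hkJ : k ∈ J := simple_mem_of_mem_posRoots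
      (inversions_subset_posRoots (inv_mem ha') ⟨isPos_simple b k, hk⟩)
    have h2 := length_mul_simple_of_not b hk
    have h3 : length b (simple b k * a') = n := by
      rw [← length_inv, mul_inv_rev, simple_inv]
      rw [length_inv b a'] at h2
      omega
    have hs := simple_mem_parabolic hkJ
    -- Removing the left descent `k ∈ J` of `a'` changes at most the `W_J` parts, so `c` and `c'`
    -- survive both cases of the lifting property.
    rcases h.simple_mul k with h4 | h4
    · rw [← mul_assoc, ← mul_assoc] at h4
      exact ih (mul_mem hs ha) (mul_mem hs ha') h4 h3
    · have h5 := h4.1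
      rw [← mul_assoc] at h5
      exact ih ha (mul_mem hs ha') h5 h3

/-- The Poincaré polynomial of the minimal coset representatives below `v`. -/
def relPoincarePoly (b : P.Base) (J : Set b.support) (v : P.weylGroup) : ℤ[X] :=
  ∑ᶠ c : {c : P.weylGroup // BruhatLE b c v ∧ c ∈ minCosetReps b J}, Polynomial.X ^ length b c.1

/-- Multiplication is a length-additive bijection from pairs (element below `u`, minimal
representative below `v`) to the interval below `u * v`. For surjectivity, `hmax` bounds the `W_J`
part and monotonicity of the projection bounds the other. -/
theorem poincarePoly_mul {J : Set b.support} {u v : P.weylGroup} (hu : u ∈ parabolic b J)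
    (hv : v ∈ minCosetReps b J) (hmax : ∀ x ∈ parabolic b J, BruhatLE b x (u * v) → BruhatLE b x u) :
    poincarePoly b (u * v) = poincarePoly b u * relPoincarePoly b J v := by
  classical
  have := finite_weylGroup (P := P)
  have := Fintype.ofFinite P.weylGroup
  have huv := length_mul_of_mem_minCosetReps hu hv
  let f : {a : P.weylGroup // BruhatLE b a u} ×
      {c : P.weylGroup // BruhatLE b c v ∧ c ∈ minCosetReps b J} →
      {y : P.weylGroup // BruhatLE b y (u * v)} :=
    fun p => ⟨p.1.1 * p.2.1, p.1.2.mul p.2.2.1 huv⟩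
  have hf : Function.Bijective f := by
    constructor
    · rintro ⟨⟨a, ha⟩, ⟨c, hc⟩⟩ ⟨⟨a', ha'⟩, ⟨c', hc'⟩⟩ h
      obtain ⟨rfl, rfl⟩ := eq_of_mul_minCosetReps_eq (ha.mem_parabolic hu)
        (ha'.mem_parabolic hu) hc.2 hc'.2 (congrArg Subtype.val h)
      rfl
    · rintro ⟨y, hy⟩
      obtain ⟨a, ha, c, hc, rfl⟩ := exists_eq_mul_minCosetReps b J y
      have hac := length_mul_of_mem_minCosetReps ha hc
      have h1 := (BruhatLE.refl a).mul (BruhatLE.one_le c) hac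
      rw [mul_one] at h1
      exact ⟨⟨⟨a, hmax a ha (h1.trans hy)⟩, ⟨c, hy.of_mul_minCosetReps ha hu hc, hc⟩⟩, rfl⟩
  unfold poincarePoly relPoincarePoly
  rw [finsum_eq_sum_of_fintype, finsum_eq_sum_of_fintype, finsum_eq_sum_of_fintype,
    Fintype.sum_mul_sum, ← Fintype.sum_prod_type', ← (Equiv.ofBijective f hf).sum_comp]
  refine Fintype.sum_congr _ _ fun p => ?_
  rw [← pow_add, ← length_mul_of_mem_minCosetReps (p.1.2.mem_parabolic hu) p.2.2.2]
  rfl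

theorem poincarePoly_inv (w : P.weylGroup) : poincarePoly b w⁻¹ = poincarePoly b w := by
  let e : {y : P.weylGroup // BruhatLE b y w} ≃ {y : P.weylGroup // BruhatLE b y w⁻¹} :=
    { toFun := fun y => ⟨y.1⁻¹, y.2.inv⟩
      invFun := fun y => ⟨y.1⁻¹, by simpa using y.2.inv⟩
      left_inv := fun y => by simp
      right_inv := fun y => by simp }
  unfold poincarePoly
  rw [← finsum_comp_equiv e]
  refine finsum_congr fun y => ?_
  change _ ^ length b (y.1⁻¹) = _
  rw [length_inv]

theorem poincarePoly_ne_zero (w : P.weylGroup) : poincarePoly b w ≠ 0 := by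
  classical
  have := finite_weylGroup (P := P)
  have := Fintype.ofFinite P.weylGroup
  intro h
  have h1 := congrArg (Polynomial.eval 1) h
  rw [poincarePoly, finsum_eq_sum_of_fintype, Polynomial.eval_finsetSum] at h1
  simp only [Polynomial.eval_pow, Polynomial.eval_X, one_pow, Finset.sum_const,
    Polynomial.eval_zero, nsmul_eq_mul, mul_one, Nat.cast_eq_zero, Finset.card_eq_zero] at h1
  have := Finset.mem_univ (⟨w, BruhatLE.refl w⟩ : {y : P.weylGroup // BruhatLE b y w})
  rw [h1] at this
  simp at this

end MinCosetReps

/-! ### Segments meeting a hyperplane. -/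

section Segments

variable {V : Type*} [AddCommGroup V] [Module ℝ V]

theorem segment_inter_ker_nonempty_iff (f : V →ₗ[ℝ] ℝ) (x y : V) :
    (segment ℝ x y ∩ (LinearMap.ker f : Set V)).Nonempty ↔ f x * f y ≤ 0 := by
  constructor
  · rintro ⟨z, ⟨s, t, hs, ht, hst, rfl⟩, hz⟩
    have hz : s * f x + t * f y = 0 := by simpa using hz
    by_contra! h
    rcases pos_and_pos_or_neg_and_neg_of_mul_pos h with ⟨h1, h2⟩ | ⟨h1, h2⟩
    · nlinarith [mul_nonneg hs h1.le, mul_nonneg ht h2.le]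
    · nlinarith [mul_nonneg hs (neg_pos.mpr h1).le, mul_nonneg ht (neg_pos.mpr h2).le]
  · intro h
    by_cases hx : f x = 0
    · exact ⟨x, left_mem_segment ℝ x y, hx⟩
    have hxy : f x - f y ≠ 0 := by
      intro h'
      have : f x * f x ≤ 0 := by rwa [← sub_eq_zero.mp h'] at h
      exact hx (mul_self_eq_zero.mp (le_antisymm this (mul_self_nonneg _)))
    have h2 : 0 < (f x - f y) * (f x - f y) := mul_self_pos.mpr hxy
    -- The zero of the affine function `f` along the segment; its weights are seen to be nonnegative
    -- after multiplying through by `f x - f y`.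
    refine ⟨(-f y / (f x - f y)) • x + (f x / (f x - f y)) • y, ⟨_, _, ?_, ?_, ?_, rfl⟩, ?_⟩
    · rw [← mul_div_mul_right _ _ hxy]
      refine div_nonneg ?_ h2.le
      nlinarith [mul_self_nonneg (f y)]
    · rw [← mul_div_mul_right _ _ hxy]
      refine div_nonneg ?_ h2.le
      nlinarith [mul_self_nonneg (f x)]
    · field_simp
      ring
    · simp only [SetLike.mem_coe, LinearMap.mem_ker, map_add, map_smul, smul_eq_mul]
      field_simp
      ring

theorem disjoint_segment_ker_iff (f : V →ₗ[ℝ] ℝ) (x y : V) :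
    Disjoint (segment ℝ x y) (LinearMap.ker f : Set V) ↔ 0 < f x * f y := by
  rw [← not_iff_not, Set.not_disjoint_iff_nonempty_inter, segment_inter_ker_nonempty_iff, not_lt]

end Segments

/-! ### Chambers encoded by their negative roots. -/

section Chambers

/-- The set of hyperplanes of the roots in `A`. -/
abbrev arr (P : RootPairing ι ℝ M N) (A : Set ι) : Set (Submodule ℝ N) := hyperplane P '' A

/-- The roots of `A` that are negative at `x`. -/
def negSet (P : RootPairing ι ℝ M N) (A : Set ι) (x : N) : Set ι := {i ∈ A | P.root' i x < 0}

/-- The point `x` lies on no hyperplane of `A`. -/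
def Regular (P : RootPairing ι ℝ M N) (A : Set ι) (x : N) : Prop := ∀ i ∈ A, P.root' i x ≠ 0

/-- The sets of roots of `A` that are the negative ones at some regular point. -/
def realizable (P : RootPairing ι ℝ M N) (A : Set ι) : Set (Set ι) :=
  {T | ∃ x, Regular P A x ∧ T = negSet P A x}

/-- The roots of `A` that are negative on a region. -/
def regionNeg (P : RootPairing ι ℝ M N) (A : Set ι) (C : Set N) : Set ι :=
  {i ∈ A | ∀ x ∈ C, P.root' i x < 0}

theorem mem_chamberAt_iff {A : Set ι} {x y : N} :
    y ∈ Arrangement.chamberAt (arr P A) x ↔ ∀ i ∈ A, 0 < P.root' i x * P.root' i y := by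
  constructor
  · intro h i hi
    exact (disjoint_segment_ker_iff _ _ _).mp (h _ ⟨i, hi, rfl⟩)
  · rintro h _ ⟨i, hi, rfl⟩
    exact (disjoint_segment_ker_iff _ _ _).mpr (h i hi)

theorem self_mem_chamberAt {A : Set ι} {x : N} (hx : Regular P A x) :
    x ∈ Arrangement.chamberAt (arr P A) x :=
  mem_chamberAt_iff.mpr fun i hi => mul_self_pos.mpr (hx i hi)

theorem mul_pos_iff_of_ne {s t : ℝ} (hs : s ≠ 0) : 0 < s * t ↔ t ≠ 0 ∧ (s < 0 ↔ t < 0) := by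
  rcases lt_or_gt_of_ne hs with h | h
  · have h1 : 0 < s * t ↔ t < 0 :=
      ⟨fun h' => neg_of_mul_pos_right h' h.le, mul_pos_of_neg_of_neg h⟩
    rw [h1]
    exact ⟨fun ht => ⟨ht.ne, iff_of_true h ht⟩, fun ht => ht.2.mp h⟩
  · rw [mul_pos_iff_of_pos_left h]
    refine ⟨fun ht => ⟨ht.ne', iff_of_false h.not_gt ht.not_gt⟩, fun ht => ?_⟩
    exact lt_of_le_of_ne (not_lt.mp fun h' => lt_asymm h (ht.2.mpr h')) ht.1.symm

theorem mem_chamberAt_iff_negSet {A : Set ι} {x y : N} (hx : Regular P A x) :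
    y ∈ Arrangement.chamberAt (arr P A) x ↔ Regular P A y ∧ negSet P A y = negSet P A x := by
  rw [mem_chamberAt_iff]
  constructor
  · intro h
    have h' := fun i hi => (mul_pos_iff_of_ne (hx i hi)).mp (h i hi)
    refine ⟨fun i hi => (h' i hi).1, ?_⟩
    ext i
    exact and_congr_right fun hi => (h' i hi).2.symm
  · rintro ⟨h1, h2⟩ i hi
    refine (mul_pos_iff_of_ne (hx i hi)).mpr ⟨h1 i hi, ?_⟩
    have := Set.ext_iff.mp h2 i
    exact ⟨fun h => (this.mpr ⟨hi, h⟩).2, fun h => (this.mp ⟨hi, h⟩).2⟩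

theorem regionNeg_chamberAt {A : Set ι} {x : N} (hx : Regular P A x) :
    regionNeg P A (Arrangement.chamberAt (arr P A) x) = negSet P A x := by
  ext i
  refine and_congr_right fun hi => ⟨fun h => h x (self_mem_chamberAt hx), fun h y hy => ?_⟩
  have := ((mem_chamberAt_iff_negSet hx).mp hy).2
  exact ((Set.ext_iff.mp this i).mpr ⟨hi, h⟩).2

theorem exists_regular_eq {A : Set ι} (C : Arrangement.Chamber (arr P A)) :
    ∃ x, Regular P A x ∧ C.carrier = Arrangement.chamberAt (arr P A) x := by
  obtain ⟨x, hx, hC⟩ := C.exists_eq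
  exact ⟨x, fun i hi h => hx _ ⟨i, hi, rfl⟩ h, hC⟩

/-- The chamber through a regular point. -/
def chamber {A : Set ι} {x : N} (hx : Regular P A x) : Arrangement.Chamber (arr P A) :=
  ⟨_, x, by rintro _ ⟨i, hi, rfl⟩ h; exact hx i hi h, rfl⟩

theorem regionNeg_chamber {A : Set ι} {x : N} (hx : Regular P A x) :
    regionNeg P A (chamber hx).carrier = negSet P A x :=
  regionNeg_chamberAt hx

theorem regionNeg_mem_realizable {A : Set ι} (C : Arrangement.Chamber (arr P A)) :
    regionNeg P A C.carrier ∈ realizable P A := by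
  obtain ⟨x, hx, hC⟩ := exists_regular_eq C
  exact ⟨x, hx, by rw [hC, regionNeg_chamberAt hx]⟩

theorem chamber_eq_of_regionNeg_eq {A : Set ι} {C D : Arrangement.Chamber (arr P A)}
    (h : regionNeg P A C.carrier = regionNeg P A D.carrier) : C = D := by
  obtain ⟨x, hx, hC⟩ := exists_regular_eq C
  obtain ⟨y, hy, hD⟩ := exists_regular_eq D
  rw [hC, hD, regionNeg_chamberAt hx, regionNeg_chamberAt hy] at h
  ext z
  rw [hC, hD, mem_chamberAt_iff_negSet hx, mem_chamberAt_iff_negSet hy, h]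

/-- Chambers correspond to the realizable sets of negative roots. -/
def chamberEquiv (P : RootPairing ι ℝ M N) (A : Set ι) :
    Arrangement.Chamber (arr P A) ≃ realizable P A :=
  Equiv.ofBijective (fun C => ⟨regionNeg P A C.carrier, regionNeg_mem_realizable C⟩) <| by
    constructor
    · intro C D h
      exact chamber_eq_of_regionNeg_eq (congrArg Subtype.val h)
    · rintro ⟨_, x, hx, rfl⟩
      exact ⟨chamber hx, Subtype.ext (regionNeg_chamber hx)⟩

theorem subset_chamber_iff {A B : Set ι} (hBA : B ⊆ A) (C : Arrangement.Chamber (arr P A))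
    (r : Arrangement.Chamber (arr P B)) :
    C.carrier ⊆ r.carrier ↔ regionNeg P A C.carrier ∩ B = regionNeg P B r.carrier := by
  obtain ⟨x, hx, hC⟩ := exists_regular_eq C
  obtain ⟨y, hy, hr⟩ := exists_regular_eq r
  have hinter : ∀ z, negSet P A z ∩ B = negSet P B z := fun z => by
    ext i
    exact ⟨fun h => ⟨h.2, h.1.2⟩, fun h => ⟨⟨hBA h.1, h.2⟩, h.1⟩⟩
  rw [hC, hr, regionNeg_chamberAt hx, regionNeg_chamberAt hy, hinter]
  constructor
  · intro h
    exact ((mem_chamberAt_iff_negSet hy).mp (h (self_mem_chamberAt hx))).2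
  · intro h z hz
    rw [mem_chamberAt_iff_negSet hx] at hz
    refine (mem_chamberAt_iff_negSet hy).mpr ⟨fun i hi => hz.1 i (hBA hi), ?_⟩
    rw [← hinter, hz.2, hinter, h]

/-- Signs are constant on chambers, so whether a segment between them meets the hyperplane does not
depend on the endpoints chosen. -/
theorem separates_iff {A : Set ι} {C D : Arrangement.Chamber (arr P A)} {i : ι} (hi : i ∈ A) :
    Arrangement.Separates (hyperplane P i) C.carrier D.carrier ↔
      i ∈ symmDiff (regionNeg P A C.carrier) (regionNeg P A D.carrier) := by
  obtain ⟨x, hx, hC⟩ := exists_regular_eq C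
  obtain ⟨y, hy, hD⟩ := exists_regular_eq D
  rw [hC, hD, regionNeg_chamberAt hx, regionNeg_chamberAt hy]
  have key : ∀ {x y : N}, Regular P A x → Regular P A y →
      ((segment ℝ x y ∩ (hyperplane P i : Set N)).Nonempty ↔
        i ∈ symmDiff (negSet P A x) (negSet P A y)) := by
    intro x y hx hy
    refine (segment_inter_ker_nonempty_iff _ _ _).trans ?_
    rw [← not_lt, mul_pos_iff_of_ne (hx i hi), Set.mem_symmDiff]
    have h1 : i ∈ negSet P A x ↔ P.root' i x < 0 := and_iff_right hi
    have h2 : i ∈ negSet P A y ↔ P.root' i y < 0 := and_iff_right hi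
    rw [h1, h2]
    have := hy i hi
    tauto
  constructor
  · intro h
    exact (key hx hy).mp (h x (self_mem_chamberAt hx) y (self_mem_chamberAt hy))
  · intro h z hz t ht
    rw [mem_chamberAt_iff_negSet hx] at hz
    rw [mem_chamberAt_iff_negSet hy] at ht
    rw [key hz.1 ht.1, hz.2, ht.2]
    exact h

theorem sepSet_eq {A : Set ι} (C D : Arrangement.Chamber (arr P A)) :
    Arrangement.sepSet (arr P A) C.carrier D.carrier =
      hyperplane P '' symmDiff (regionNeg P A C.carrier) (regionNeg P A D.carrier) := by
  ext H
  constructor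
  · rintro ⟨⟨i, hi, rfl⟩, h⟩
    exact ⟨i, (separates_iff hi).mp h, rfl⟩
  · rintro ⟨i, hi, rfl⟩
    have hiA : i ∈ A := by
      rcases Set.mem_symmDiff.mp hi with h | h
      exacts [h.1.1, h.1.1]
    exact ⟨⟨i, hiA, rfl⟩, (separates_iff hiA).mpr hi⟩

end Chambers

/-! ### Distances and covers in terms of negative sets. -/

section Poset

variable [Finite ι] [P.IsRootSystem] [P.IsCrystallographic] [P.IsReduced] {b : P.Base}

theorem root'_injective {i j : ι} {s t : ℝ} (hs : s ≠ 0) (hi : b.IsPos i) (hj : b.IsPos j)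
    (h : ∀ x : N, s * P.root' i x = t * P.root' j x) : i = j := by
  have h1 : s • P.root i = t • P.root j := by
    apply P.toPerfPair.injective
    ext x
    rw [map_smul, map_smul]
    exact h x
  by_contra hij
  have h2 : P.root i ≠ -P.root j := by
    intro h2
    rw [root_eq_neg_iff] at h2
    rw [h2, isPos_neg_iff] at hi
    exact hi hj
  have h3 := LinearIndependent.pair_iff.mp (IsReduced.linearIndependent P hij h2) s (-t)
    (by rw [h1, neg_smul, add_neg_cancel])
  exact hs h3.1

theorem hyperplane_injOn : Set.InjOn (hyperplane P) {i | b.IsPos i} := by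
  intro i hi j hj h
  refine root'_injective (b := b) (s := 2) (t := P.pairing i j) two_ne_zero hi hj fun x => ?_
  -- Twice the projection of `x` to the hyperplane of `j` along the coroot. Evaluating root `i` on
  -- it shows that the two roots are proportional.
  have h1 : (2 : ℝ) • x - P.root' j x • P.coroot j ∈ hyperplane P j := by
    change P.root' j _ = 0
    rw [map_sub, map_smul, map_smul, root'_coroot_eq_pairing, pairing_same, smul_eq_mul,
      smul_eq_mul, mul_comm, sub_self]
  rw [← h] at h1
  have h2 : P.root' i ((2 : ℝ) • x - P.root' j x • P.coroot j) = 0 := h1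
  rw [map_sub, map_smul, map_smul, root'_coroot_eq_pairing, smul_eq_mul, smul_eq_mul] at h2
  linarith

variable {A : Set ι} (hA : A ⊆ {i | b.IsPos i})
include hA

theorem mem_fundamentalChamber_iff {x : N} :
    x ∈ fundamentalChamber b (arr P A) ↔ ∀ i ∈ A, 0 < P.root' i x := by
  constructor
  · exact fun h i hi => h i (hA hi) ⟨i, hi, rfl⟩
  · rintro h i hi ⟨j, hj, hij⟩
    rw [← hyperplane_injOn (hA hj) hi hij]
    exact h j hj

theorem exists_fundamentalChamber_eq : ∃ C : Arrangement.Chamber (arr P A),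
    C.carrier = fundamentalChamber b (arr P A) ∧ regionNeg P A C.carrier = ∅ := by
  obtain ⟨ρ, hρ⟩ := exists_dominant b
  have h1 : Regular P A ρ := fun i hi => ((hρ i).mp (hA hi)).ne'
  refine ⟨chamber h1, ?_, ?_⟩
  · ext x
    rw [mem_fundamentalChamber_iff hA]
    refine mem_chamberAt_iff.trans (forall₂_congr fun i hi => ?_)
    exact mul_pos_iff_of_pos_left ((hρ i).mp (hA hi))
  · rw [regionNeg_chamber]
    ext i
    simp only [Set.mem_empty_iff_false, iff_false]
    exact fun h => lt_asymm h.2 ((hρ i).mp (hA h.1))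

theorem ncard_hyperplane_image {T : Set ι} (hT : T ⊆ A) :
    (hyperplane P '' T).ncard = T.ncard :=
  (hyperplane_injOn.mono (hT.trans hA)).ncard_image

theorem symmDiff_subset (C D : Set N) :
    symmDiff (regionNeg P A C) (regionNeg P A D) ⊆ A := fun i hi => by
  rcases Set.mem_symmDiff.mp hi with h | h
  exacts [h.1.1, h.1.1]

theorem dist_fundamentalChamber (D : Arrangement.Chamber (arr P A)) :
    Arrangement.dist (arr P A) (fundamentalChamber b (arr P A)) D.carrier =
      (regionNeg P A D.carrier).ncard := by
  obtain ⟨C, h1, h2⟩ := exists_fundamentalChamber_eq hA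
  rw [← h1, Arrangement.dist, sepSet_eq, ncard_hyperplane_image hA (symmDiff_subset hA _ _), h2]
  congr 1
  exact bot_symmDiff _

theorem covers_iff {C D : Arrangement.Chamber (arr P A)} :
    Arrangement.Covers (arr P A) (fundamentalChamber b (arr P A)) C D ↔
      ∃ i ∉ regionNeg P A C.carrier,
        regionNeg P A D.carrier = insert i (regionNeg P A C.carrier) := by
  have hfin : ∀ T : Set ι, T.Finite := fun T => T.toFinite
  rw [Arrangement.Covers, dist_fundamentalChamber hA, dist_fundamentalChamber hA,
    Arrangement.Adjacent, sepSet_eq]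
  have hsub := symmDiff_subset hA C.carrier D.carrier
  constructor
  · rintro ⟨⟨H, hH⟩, hd⟩
    have h1 : (symmDiff (regionNeg P A C.carrier) (regionNeg P A D.carrier)).ncard = 1 := by
      rw [← ncard_hyperplane_image hA hsub, hH, Set.ncard_singleton]
    obtain ⟨i, hi⟩ := Set.ncard_eq_one.mp h1
    have hmem : ∀ j, j ≠ i → (j ∈ regionNeg P A D.carrier ↔ j ∈ regionNeg P A C.carrier) := by
      intro j hj
      have : j ∉ symmDiff (regionNeg P A C.carrier) (regionNeg P A D.carrier) := by
        rw [hi]; exact hj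
      rw [Set.mem_symmDiff] at this
      tauto
    have hi' : i ∈ symmDiff (regionNeg P A C.carrier) (regionNeg P A D.carrier) := by
      rw [hi]; rfl
    rcases Set.mem_symmDiff.mp hi' with ⟨h2, h3⟩ | ⟨h2, h3⟩
    · exfalso
      have : regionNeg P A D.carrier ⊆ regionNeg P A C.carrier := fun j hj =>
        (hmem j (by rintro rfl; exact h3 hj)).mp hj
      have := Set.ncard_le_ncard this
      omega
    · refine ⟨i, h3, ?_⟩
      ext j
      by_cases hj : j = i
      · subst hj; exact iff_of_true h2 (Set.mem_insert _ _)
      · rw [hmem j hj, Set.mem_insert_iff, or_iff_right hj]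
  · rintro ⟨i, hi, h⟩
    refine ⟨⟨hyperplane P i, ?_⟩, by rw [h, Set.ncard_insert_of_notMem hi]⟩
    rw [h, ← Set.image_singleton]
    congr 1
    ext j
    rw [Set.mem_symmDiff, Set.mem_insert_iff, Set.mem_singleton_iff]
    constructor
    · tauto
    · rintro rfl
      exact Or.inr ⟨Or.inl rfl, hi⟩

end Poset

/-! ### Fibres of sign patterns and their rank polynomials. -/

section Fibre

/-- The sets of roots of `D` that are negative at some regular point of `B ∪ D` whose negative
roots in `B` are those in `n`. -/
def fibre (P : RootPairing ι ℝ M N) (B n D : Set ι) : Set (Set ι) :=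
  {T | ∃ z, Regular P (B ∪ D) z ∧ negSet P B z = n ∧ negSet P D z = T}

/-- The order on a family of sets generated by adding one element at a time. -/
def StepLE (F : Set (Set ι)) : F → F → Prop :=
  Relation.ReflTransGen fun S T => ∃ i ∉ S.1, T.1 = insert i S.1

theorem StepLE.subset {F : Set (Set ι)} {S T : F} (h : StepLE F S T) : S.1 ⊆ T.1 := by
  induction h with
  | refl => exact subset_rfl
  | tail _ h ih =>
    obtain ⟨i, -, h⟩ := h
    rw [h]
    exact ih.trans (Set.subset_insert _ _)

/-- Removing elements one at a time gives a chain below `T` with as many steps as `T` has elements.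
Its image is strictly increasing for inclusion. -/
theorem ncard_le_of_strictMono [Finite ι] {F G : Set (Set ι)}
    (hF : ∀ T ∈ F, T.Nonempty → ∃ i ∈ T, T \ {i} ∈ F) (e : F → G) (he : Function.Injective e)
    (hmono : ∀ S T, StepLE F S T → StepLE G (e S) (e T)) (T : F) :
    T.1.ncard ≤ (e T).1.ncard := by
  induction hn : T.1.ncard generalizing T with
  | zero => exact Nat.zero_le _
  | succ n ih =>
    have hne : T.1.Nonempty := by
      rw [← Set.ncard_pos T.1.toFinite]
      omega
    obtain ⟨i, hi, hiF⟩ := hF T.1 T.2 hne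
    have h1 := Set.ncard_sdiff_singleton_add_one hi T.1.toFinite
    have h2 := ih ⟨_, hiF⟩ (by dsimp only; omega)
    have h3 : StepLE F ⟨_, hiF⟩ T := by
      refine Relation.ReflTransGen.single ⟨i, by simp, ?_⟩
      simp [Set.insert_eq_of_mem hi]
    have h4 := (hmono _ _ h3).subset
    have h5 : (e ⟨_, hiF⟩).1 ≠ (e T).1 := fun h => by
      have h6 : T.1 \ {i} = T.1 := congrArg Subtype.val (he (Subtype.ext h))
      rw [← h6] at hi
      exact hi.2 rfl
    have h6 := Set.ncard_lt_ncard (lt_of_le_of_ne h4 h5)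
    omega

/-- The rank generating function of a family of finite sets. -/
def setPoly (F : Set (Set ι)) : ℤ[X] := ∑ᶠ T : F, Polynomial.X ^ T.1.ncard

theorem setPoly_eq_of_equiv {F : Set (Set ι)} {κ : Type*} {G : Set (Set κ)} (e : F ≃ G)
    (he : ∀ T, (e T).1.ncard = T.1.ncard) : setPoly F = setPoly G := by
  unfold setPoly
  rw [← finsum_comp_equiv e]
  exact finsum_congr fun T => by rw [he]

theorem setPoly_eq_of_stepLE_iff [Finite ι] {F G : Set (Set ι)}
    (hF : ∀ T ∈ F, T.Nonempty → ∃ i ∈ T, T \ {i} ∈ F)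
    (hG : ∀ T ∈ G, T.Nonempty → ∃ i ∈ T, T \ {i} ∈ G) (e : F ≃ G)
    (he : ∀ S T, StepLE G (e S) (e T) ↔ StepLE F S T) : setPoly F = setPoly G := by
  refine setPoly_eq_of_equiv e fun T => le_antisymm ?_ ?_
  · have := ncard_le_of_strictMono hG e.symm e.symm.injective
      (fun S T h => by rw [← he, e.apply_symm_apply, e.apply_symm_apply]; exact h) (e T)
    rwa [e.symm_apply_apply] at this
  · exact ncard_le_of_strictMono hF e e.injective (fun S T h => (he S T).mpr h) T

theorem negSet_union (B D : Set ι) (z : N) :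
    negSet P (B ∪ D) z = negSet P B z ∪ negSet P D z := by
  ext i
  exact or_and_right

theorem negSet_inter {A B : Set ι} (h : B ⊆ A) (z : N) : negSet P A z ∩ B = negSet P B z := by
  ext i
  exact ⟨fun hi => ⟨hi.2, hi.1.2⟩, fun hi => ⟨⟨h hi.1, hi.2⟩, hi.1⟩⟩

/-- Sort the chambers of `B ∪ D` by the chamber of `B` containing them; cardinalities add because
`B` and `D` are disjoint. -/
theorem setPoly_realizable_union [Finite ι] {B D : Set ι} (hBD : Disjoint B D) {G : ℤ[X]}
    (hG : ∀ n ∈ realizable P B, setPoly (fibre P B n D) = G) :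
    setPoly (realizable P (B ∪ D)) = setPoly (realizable P B) * G := by
  classical
  let f : (Σ n : realizable P B, fibre P B n.1 D) → realizable P (B ∪ D) := fun p =>
    ⟨p.1.1 ∪ p.2.1, by
      obtain ⟨n, T, z, hz, h1, h2⟩ := p
      exact ⟨z, hz, show n.1 ∪ T = _ by rw [negSet_union, h1, h2]⟩⟩
  have hf : Function.Bijective f := by
    constructor
    · have key : ∀ p, (f p).1 ∩ B = p.1.1 ∧ (f p).1 ∩ D = p.2.1 := by
        rintro ⟨n, T, z, hz, h1, h2⟩
        have h3 : n.1 ∪ T = negSet P (B ∪ D) z := by rw [negSet_union, h1, h2]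
        change (n.1 ∪ T) ∩ B = n.1 ∧ (n.1 ∪ T) ∩ D = T
        rw [h3, negSet_inter Set.subset_union_left, negSet_inter Set.subset_union_right]
        exact ⟨h1, h2⟩
      intro p q h
      have hp := key p
      rw [h, (key q).1, (key q).2] at hp
      obtain ⟨n, T⟩ := p
      obtain ⟨n', T'⟩ := q
      obtain rfl : n' = n := Subtype.ext hp.1
      obtain rfl : T' = T := Subtype.ext hp.2
      rfl
    · rintro ⟨_, z, hz, rfl⟩
      exact ⟨⟨⟨negSet P B z, z, fun i hi => hz i (Or.inl hi), rfl⟩, ⟨negSet P D z, z, hz, rfl, rfl⟩⟩,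
        Subtype.ext (negSet_union B D z).symm⟩
  have := Fintype.ofFinite (realizable P B)
  have := fun n : realizable P B => Fintype.ofFinite (fibre P B n.1 D)
  have := Fintype.ofFinite (realizable P (B ∪ D))
  unfold setPoly at *
  rw [finsum_eq_sum_of_fintype, finsum_eq_sum_of_fintype, ← (Equiv.ofBijective f hf).sum_comp,
    Fintype.sum_sigma, Finset.sum_mul]
  refine Fintype.sum_congr _ _ fun n => ?_
  rw [← hG n.1 n.2, finsum_eq_sum_of_fintype, Finset.mul_sum]
  refine Fintype.sum_congr _ _ fun T => ?_
  rw [← pow_add, ← Set.ncard_union_eq ?_ (Set.toFinite _) (Set.toFinite _)]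
  · rfl
  · obtain ⟨T, z, hz, h1, h2⟩ := T
    have h3 : n.1 ⊆ B := by rw [← h1]; exact fun i hi => hi.1
    have h4 : T ⊆ D := by rw [← h2]; exact fun i hi => hi.1
    exact hBD.mono h3 h4

/-- Regular points for `B₀ ∪ D` and `B` that agree on `B₀` have a common refinement. -/
def Amalgamates (P : RootPairing ι ℝ M N) (B₀ B D : Set ι) : Prop :=
  ∀ x y : N, Regular P (B₀ ∪ D) x → Regular P B y → negSet P B₀ x = negSet P B₀ y →
    ∃ z, Regular P (B ∪ D) z ∧ negSet P B z = negSet P B y ∧ negSet P D z = negSet P D x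

/-- Restricting a point from `B` to `B₀` gives one inclusion, and amalgamation gives the other. -/
theorem fibre_eq_of_amalgamates {B₀ B D n : Set ι} (hB : B₀ ⊆ B) (h : Amalgamates P B₀ B D)
    (hn : n ∈ realizable P B) : fibre P B n D = fibre P B₀ (n ∩ B₀) D := by
  ext T
  constructor
  · rintro ⟨z, hz, h1, h2⟩
    exact ⟨z, fun i hi => hz i (hi.imp_left (@hB i)), by rw [← h1, negSet_inter hB], h2⟩
  · rintro ⟨x, hx, h1, h2⟩
    obtain ⟨y, hy, rfl⟩ := hn
    rw [negSet_inter hB] at h1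
    obtain ⟨z, hz, h3, h4⟩ := h x y hx hy h1
    exact ⟨z, hz, h3, h4.trans h2⟩

theorem inter_mem_realizable {B₀ B n : Set ι} (hB : B₀ ⊆ B) (hn : n ∈ realizable P B) :
    n ∩ B₀ ∈ realizable P B₀ := by
  obtain ⟨y, hy, rfl⟩ := hn
  exact ⟨y, fun i hi => hy i (hB hi), negSet_inter hB y⟩

end Fibre

/-! ### Induced posets of chambers as fibres. -/

section Induced

variable [Finite ι] [P.IsRootSystem] [P.IsCrystallographic] [P.IsReduced] {b : P.Base}

theorem distPoly_eq_setPoly {A : Set ι} (hA : A ⊆ {i | b.IsPos i}) :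
    Arrangement.distPoly (arr P A) (fundamentalChamber b (arr P A)) =
      setPoly (realizable P A) := by
  unfold Arrangement.distPoly setPoly
  rw [← finsum_comp_equiv (chamberEquiv P A)]
  exact finsum_congr fun C => by rw [dist_fundamentalChamber hA]; rfl

theorem regionNeg_inter_mem_fibre {B D : Set ι} (r : Arrangement.Chamber (arr P B))
    (C : Arrangement.Chamber (arr P (B ∪ D))) (hC : C.carrier ⊆ r.carrier) :
    regionNeg P (B ∪ D) C.carrier ∩ D ∈ fibre P B (regionNeg P B r.carrier) D := by
  rw [subset_chamber_iff Set.subset_union_left] at hC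
  obtain ⟨z, hz, h⟩ := exists_regular_eq C
  rw [h, regionNeg_chamberAt hz] at hC ⊢
  rw [negSet_inter Set.subset_union_left] at hC
  rw [negSet_inter Set.subset_union_right]
  exact ⟨z, hz, hC, rfl⟩

theorem regionNeg_eq_union {B D : Set ι} {r : Arrangement.Chamber (arr P B)}
    {C : Arrangement.Chamber (arr P (B ∪ D))} (hC : C.carrier ⊆ r.carrier) :
    regionNeg P (B ∪ D) C.carrier =
      regionNeg P B r.carrier ∪ regionNeg P (B ∪ D) C.carrier ∩ D := by
  rw [← (subset_chamber_iff Set.subset_union_left C r).mp hC, ← Set.inter_union_distrib_left,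
    eq_comm, Set.inter_eq_left]
  exact fun i hi => hi.1

/-- The chambers inside `r` correspond to the fibre over the negative set of `r`. -/
def inducedEquiv (B D : Set ι) (r₀ : Set N) (r : Arrangement.Chamber (arr P B)) :
    Arrangement.InducedPoset (arr P (B ∪ D)) r₀ r.carrier ≃
      fibre P B (regionNeg P B r.carrier) D :=
  Equiv.ofBijective
    (fun C => ⟨regionNeg P (B ∪ D) (Arrangement.Chamber.carrier C.1) ∩ D,
      regionNeg_inter_mem_fibre r C.1 C.2⟩) <| by
    constructor
    · rintro ⟨C, hC⟩ ⟨C', hC'⟩ h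
      have h1 := congrArg Subtype.val h
      dsimp only at h1
      refine Subtype.ext (chamber_eq_of_regionNeg_eq ?_)
      rw [regionNeg_eq_union hC, regionNeg_eq_union hC', h1]
    · rintro ⟨T, z, hz, h1, h2⟩
      refine ⟨⟨chamber hz, ?_⟩, Subtype.ext ?_⟩
      · refine (subset_chamber_iff Set.subset_union_left (chamber hz) r).mpr ?_
        rw [regionNeg_chamber, negSet_inter Set.subset_union_left, h1]
      · change regionNeg P (B ∪ D) (chamber hz).carrier ∩ D = T
        rw [regionNeg_chamber, negSet_inter Set.subset_union_right, h2]

theorem regionNeg_subset_of_le {A : Set ι} (hA : A ⊆ {i | b.IsPos i})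
    {C D : Arrangement.Chamber (arr P A)}
    (h : Relation.ReflTransGen (Arrangement.Covers (arr P A) (fundamentalChamber b (arr P A))) C D) :
    regionNeg P A C.carrier ⊆ regionNeg P A D.carrier := by
  induction h with
  | refl => exact subset_rfl
  | tail _ h ih =>
    obtain ⟨i, -, h⟩ := (covers_iff hA).mp h
    rw [h]
    exact ih.trans (Set.subset_insert _ _)

/-- The order on the whole poset is generated by covers that might leave `r`. They do not: negative
sets grow along a chain, and both ends have the same part in `B`, so only roots of `D` are added. -/
theorem stepLE_inducedEquiv_iff {B D : Set ι} (hA : B ∪ D ⊆ {i | b.IsPos i})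
    (r : Arrangement.Chamber (arr P B))
    (C C' : Arrangement.InducedPoset (arr P (B ∪ D)) (fundamentalChamber b (arr P (B ∪ D)))
      r.carrier) :
    StepLE _ (inducedEquiv B D _ r C) (inducedEquiv B D _ r C') ↔ C ≤ C' := by
  constructor
  · intro h
    generalize hT : inducedEquiv B D _ r C' = T at h
    induction h generalizing C' with
    | refl => exact ((inducedEquiv B D _ r).injective hT).ge
    | @tail S T _ h ih =>
      obtain ⟨C'', rfl⟩ :=
        (inducedEquiv B D (fundamentalChamber b (arr P (B ∪ D))) r).surjective S
      refine (ih C'' rfl).trans ?_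
      obtain ⟨i, hi, h⟩ := h
      rw [← hT] at h
      have h' : regionNeg P (B ∪ D) (Arrangement.Chamber.carrier C'.1) ∩ D =
        insert i (regionNeg P (B ∪ D) (Arrangement.Chamber.carrier C''.1) ∩ D) := h
      have hi' : i ∉ regionNeg P (B ∪ D) (Arrangement.Chamber.carrier C''.1) ∩ D := hi
      have hiD : i ∈ D := by
        have : i ∈ regionNeg P (B ∪ D) (Arrangement.Chamber.carrier C'.1) ∩ D := by
          rw [h']; exact Set.mem_insert _ _
        exact this.2
      refine Relation.ReflTransGen.single ((covers_iff hA).mpr ⟨i, fun h2 => hi' ⟨h2, hiD⟩, ?_⟩)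
      rw [regionNeg_eq_union C'.2, h', Set.union_insert, ← regionNeg_eq_union C''.2]
  · obtain ⟨C, hC⟩ := C
    obtain ⟨C', hC'⟩ := C'
    intro h
    have h : Relation.ReflTransGen (Arrangement.Covers (arr P (B ∪ D))
      (fundamentalChamber b (arr P (B ∪ D)))) C C' := h
    induction h using Relation.ReflTransGen.head_induction_on with
    | refl => exact Relation.ReflTransGen.refl
    | @head C C₁ h1 h2 ih =>
      have hle := regionNeg_subset_of_le hA h2
      obtain ⟨i, hi, h⟩ := (covers_iff hA).mp h1
      have e := (subset_chamber_iff Set.subset_union_left C r).mp hC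
      have e' := (subset_chamber_iff Set.subset_union_left C' r).mp hC'
      have hiA : i ∈ B ∪ D := by
        have : i ∈ regionNeg P (B ∪ D) C₁.carrier := by rw [h]; exact Set.mem_insert _ _
        exact this.1
      have hiB : i ∉ B := fun hiB => by
        have h3 : i ∈ regionNeg P (B ∪ D) C'.carrier ∩ B :=
          ⟨hle (by rw [h]; exact Set.mem_insert _ _), hiB⟩
        rw [e', ← e] at h3
        exact hi h3.1
      have hC₁ : C₁.carrier ⊆ r.carrier := by
        refine (subset_chamber_iff Set.subset_union_left C₁ r).mpr ?_
        rw [h, Set.insert_inter_of_notMem hiB, e]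
      refine Relation.ReflTransGen.head ⟨i, fun h3 => hi h3.1, ?_⟩ (ih hC₁ h2)
      change regionNeg P (B ∪ D) C₁.carrier ∩ D = insert i (regionNeg P (B ∪ D) C.carrier ∩ D)
      rw [h, Set.insert_inter_of_mem (hiA.resolve_left hiB)]

/-- Induced posets over chambers with the same fibre are isomorphic. -/
theorem nonempty_orderIso_of_fibre_eq {B B' D : Set ι} (hA : B ∪ D ⊆ {i | b.IsPos i})
    (hA' : B' ∪ D ⊆ {i | b.IsPos i}) (r : Arrangement.Chamber (arr P B))
    (r' : Arrangement.Chamber (arr P B'))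
    (h : fibre P B (regionNeg P B r.carrier) D = fibre P B' (regionNeg P B' r'.carrier) D) :
    Nonempty
      (Arrangement.InducedPoset (arr P (B ∪ D)) (fundamentalChamber b (arr P (B ∪ D))) r.carrier ≃o
        Arrangement.InducedPoset (arr P (B' ∪ D)) (fundamentalChamber b (arr P (B' ∪ D)))
          r'.carrier) := by
  have key : ∀ {F G : Set (Set ι)} (h : F = G) (S T : F),
      StepLE G (Equiv.setCongr h S) (Equiv.setCongr h T) ↔ StepLE F S T := by
    rintro F _ rfl S T
    exact Iff.rfl
  refine ⟨⟨(inducedEquiv B D _ r).trans ((Equiv.setCongr h).trans (inducedEquiv B' D _ r').symm),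
    ?_⟩⟩
  intro C C'
  rw [← stepLE_inducedEquiv_iff hA, ← stepLE_inducedEquiv_iff hA', ← key h]
  simp only [Equiv.trans_apply, Equiv.apply_symm_apply]

end Induced

/-! ### Generic points and gradedness of fibres. -/

section Generic

variable [Finite ι] [P.IsRootSystem] [P.IsCrystallographic] [P.IsReduced] {b : P.Base}

theorem exists_pos_lt {κ : Type*} [Finite κ] (c : κ → ℝ) :
    ∃ δ > 0, ∀ k, 0 < c k → δ < c k := by
  by_cases hne : {k | 0 < c k}.Nonempty
  · obtain ⟨k, hk, hm⟩ := Set.exists_min_image {k | 0 < c k} c (Set.toFinite _) hne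
    have hk : 0 < c k := hk
    refine ⟨c k / 2, half_pos hk, fun l hl => ?_⟩
    have := hm l hl
    linarith
  · exact ⟨1, one_pos, fun k hk => absurd ⟨k, hk⟩ hne⟩

/-- Finitely many nonzero functionals are all nonzero at some point near `y`, where they keep the
sign that they have at `y`. -/
theorem exists_generic_near {κ : Type*} [Finite κ] (h : κ → Module.Dual ℝ N) (hne : ∀ k, h k ≠ 0)
    (y : N) : ∃ y', ∀ k, h k y' ≠ 0 ∧ (h k y ≠ 0 → (h k y' < 0 ↔ h k y < 0)) := by
  obtain ⟨d, hd⟩ := Module.Dual.exists_forall_ne_zero_of_forall_exists h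
    (fun k => by by_contra! h'; exact hne k (LinearMap.ext h'))
  -- Move from `y` along a direction `d` on which no functional vanishes, by a step too small to
  -- change any nonzero sign.
  obtain ⟨ε, hε, hε'⟩ := exists_pos_lt (fun k => |h k y| / |h k d|)
  refine ⟨y + ε • d, fun k => ?_⟩
  rw [map_add, map_smul, smul_eq_mul]
  have hdk := abs_pos.mpr (hd k)
  by_cases hy : h k y = 0
  · exact ⟨by rw [hy, zero_add]; exact mul_ne_zero hε.ne' (hd k), fun h' => absurd hy h'⟩
  · have h1 := hε' k (div_pos (abs_pos.mpr hy) hdk)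
    rw [lt_div_iff₀ hdk] at h1
    have h2 : |ε * h k d| < |h k y| := by rwa [abs_mul, abs_of_pos hε]
    rcases lt_or_gt_of_ne hy with h3 | h3
    · rw [abs_of_neg h3] at h2
      have := (abs_lt.mp h2).2
      exact ⟨by linarith, fun _ => iff_of_true (by linarith) h3⟩
    · rw [abs_of_pos h3] at h2
      have := (abs_lt.mp h2).1
      exact ⟨by linarith, fun _ => iff_of_false (by linarith) h3.not_gt⟩

/-- In a fibre containing the empty set, one can remove the elements of a set one at a time. -/
theorem exists_sdiff_singleton_mem_fibre {B D n : Set ι} (hA : B ∪ D ⊆ {i | b.IsPos i})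
    (h₀ : ∅ ∈ fibre P B n D) :
    ∀ T ∈ fibre P B n D, T.Nonempty → ∃ i ∈ T, T \ {i} ∈ fibre P B n D := by
  rintro T ⟨y, hy, hyB, hyD⟩ hT
  obtain ⟨x, hx, hxB, hxD⟩ := h₀
  have hxpos : ∀ i ∈ D, 0 < P.root' i x := fun i hi => by
    refine lt_of_le_of_ne (not_lt.mp fun h => ?_) (hx i (Or.inr hi)).symm
    have : i ∈ negSet P D x := ⟨hi, h⟩
    rw [hxD] at this
    exact this
  have hTD : T ⊆ D := by rw [← hyD]; exact fun i hi => hi.1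
  let κ := {p : ι × ι // p.1 ∈ D ∧ p.2 ∈ D ∧ p.1 ≠ p.2}
  -- The second family vanishes at `y'` exactly when the ray from `y'` in direction `x` would meet
  -- the two hyperplanes of `p` at the same parameter.
  let h : ι ⊕ κ → Module.Dual ℝ N := Sum.elim P.root' fun p =>
    P.root' p.1.2 x • P.root' p.1.1 - P.root' p.1.1 x • P.root' p.1.2
  have hne : ∀ k, h k ≠ 0 := by
    rintro (i | ⟨⟨i, j⟩, hi, hj, hij⟩) h0
    · have := LinearMap.congr_fun h0 (P.coroot i)
      simp [h] at this
    · refine hij (root'_injective (b := b) (hxpos j hj).ne' (t := P.root' i x) (hA (Or.inr hi))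
        (hA (Or.inr hj)) fun z => ?_)
      have := LinearMap.congr_fun h0 z
      simpa [h, sub_eq_zero] using this
  obtain ⟨y', hy'⟩ := exists_generic_near h hne y
  have hsign : ∀ i ∈ B ∪ D, P.root' i y' < 0 ↔ P.root' i y < 0 := fun i hi =>
    (hy' (Sum.inl i)).2 (hy i hi)
  have hreg : ∀ i, P.root' i y' ≠ 0 := fun i => (hy' (Sum.inl i)).1
  have hgen : ∀ i ∈ D, ∀ j ∈ D, i ≠ j →
      P.root' j x * P.root' i y' ≠ P.root' i x * P.root' j y' := fun i hi j hj hij => by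
    have := (hy' (Sum.inr ⟨(i, j), hi, hj, hij⟩)).1
    simpa [h, sub_eq_zero] using this
  have hneg : ∀ i, i ∈ T ↔ i ∈ D ∧ P.root' i y' < 0 := fun i => by
    rw [← hyD]
    exact and_congr_right fun hi => (hsign i (Or.inr hi)).symm
  -- The parameter at which `y' + s • x` crosses the hyperplane of `i`.
  let c : ι → ℝ := fun i => -P.root' i y' / P.root' i x
  have hc : ∀ i ∈ D, ∀ s, P.root' i (y' + s • x) < 0 ↔ s < c i := fun i hi s => by
    rw [map_add, map_smul, smul_eq_mul, lt_div_iff₀ (hxpos i hi)]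
    constructor <;> intro h <;> linarith
  have hc0 : ∀ i ∈ D, ∀ s, P.root' i (y' + s • x) = 0 ↔ s = c i := fun i hi s => by
    rw [map_add, map_smul, smul_eq_mul, eq_div_iff (hxpos i hi).ne']
    constructor <;> intro h <;> linarith
  obtain ⟨i, hi, hmin⟩ := Set.exists_min_image T c T.toFinite hT
  have hci : 0 < c i := div_pos (neg_pos.mpr ((hneg i).mp hi).2) (hxpos i (hTD hi))
  -- Stop just after the first crossing `c i` and before the next. Nothing in `B` is crossed,
  -- because `x` and `y` have the same signs there.
  obtain ⟨δ, hδ, hδ'⟩ := exists_pos_lt fun j => c j - c i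
  have hlt : ∀ j ∈ T, j ≠ i → c i < c j := fun j hj hji => by
    refine lt_of_le_of_ne (hmin j hj) fun h => ?_
    rw [div_eq_div_iff (hxpos i (hTD hi)).ne' (hxpos j (hTD hj)).ne'] at h
    exact hgen i (hTD hi) j (hTD hj) hji.symm (by linarith)
  have hsB : ∀ j ∈ B, P.root' j x < 0 ↔ P.root' j y < 0 := fun j hj => by
    have := Set.ext_iff.mp (hxB.trans hyB.symm) j
    exact ⟨fun h => (this.mp ⟨hj, h⟩).2, fun h => (this.mpr ⟨hj, h⟩).2⟩
  have hposs : 0 < c i + δ := add_pos hci hδ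
  have hB : ∀ j ∈ B, P.root' j (y' + (c i + δ) • x) ≠ 0 ∧
      (P.root' j (y' + (c i + δ) • x) < 0 ↔ P.root' j y < 0) := fun j hj => by
    rw [map_add, map_smul, smul_eq_mul]
    by_cases hneg : P.root' j y < 0
    · have h1 := (hsign j (Or.inl hj)).mpr hneg
      have h2 := mul_neg_of_pos_of_neg hposs ((hsB j hj).mpr hneg)
      exact ⟨by linarith, iff_of_true (by linarith) hneg⟩
    · have h1 := lt_of_le_of_ne (not_lt.mp fun h => hneg ((hsign j (Or.inl hj)).mp h))
        (hreg j).symm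
      have h2 := lt_of_le_of_ne (not_lt.mp fun h => hneg ((hsB j hj).mp h))
        (hx j (Or.inl hj)).symm
      have h3 := mul_pos hposs h2
      exact ⟨by linarith, iff_of_false (by linarith) hneg⟩
  have hD : ∀ j ∈ D, c i + δ ≠ c j ∧ (c i + δ < c j ↔ j ∈ T \ {i}) := fun j hj => by
    by_cases hjT : j ∈ T
    · by_cases hji : j = i
      · subst hji
        exact ⟨by linarith, iff_of_false (by linarith) fun h => h.2 rfl⟩
      · have h1 := hδ' j (sub_pos.mpr (hlt j hjT hji))
        exact ⟨by linarith, iff_of_true (by linarith) ⟨hjT, hji⟩⟩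
    · have h1 : c j < 0 := by
        have : 0 < P.root' j y' := lt_of_le_of_ne
          (not_lt.mp fun h => hjT ((hneg j).mpr ⟨hj, h⟩)) (hreg j).symm
        exact div_neg_of_neg_of_pos (neg_neg_of_pos this) (hxpos j hj)
      exact ⟨by linarith, iff_of_false (by linarith) fun h => hjT h.1⟩
  refine ⟨i, hi, y' + (c i + δ) • x, ?_, ?_, ?_⟩
  · rintro j (hj | hj)
    · exact (hB j hj).1
    · rw [ne_eq, hc0 j hj]
      exact (hD j hj).1
  · rw [← hyB]
    ext j
    exact and_congr_right fun hj => (hB j hj).2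
  · ext j
    constructor
    · rintro ⟨hj, h⟩
      exact (hD j hj).2.mp ((hc j hj _).mp h)
    · intro h
      exact ⟨hTD h.1, (hc j (hTD h.1) _).mpr ((hD j (hTD h.1)).2.mpr h)⟩

/-- Uniformity makes the rank generating functions of the fibres equal. -/
theorem setPoly_fibre_eq_of_uniform {B D : Set ι} (hA : B ∪ D ⊆ {i | b.IsPos i})
    (h₀ : ∀ n ∈ realizable P B, ∅ ∈ fibre P B n D)
    (hU : Arrangement.Uniform (arr P (B ∪ D)) (fundamentalChamber b (arr P (B ∪ D))) (arr P B))
    {n n' : Set ι} (hn : n ∈ realizable P B) (hn' : n' ∈ realizable P B) :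
    setPoly (fibre P B n D) = setPoly (fibre P B n' D) := by
  obtain ⟨x, hx, rfl⟩ := hn
  obtain ⟨x', hx', rfl⟩ := hn'
  rw [← regionNeg_chamber hx, ← regionNeg_chamber hx']
  obtain ⟨e⟩ := hU (chamber hx) (chamber hx')
  refine setPoly_eq_of_stepLE_iff
    (exists_sdiff_singleton_mem_fibre hA (h₀ _ (regionNeg_mem_realizable _)))
    (exists_sdiff_singleton_mem_fibre hA (h₀ _ (regionNeg_mem_realizable _)))
    ((inducedEquiv B D _ (chamber hx)).symm.trans
      (e.toEquiv.trans (inducedEquiv B D _ (chamber hx')))) fun S T => ?_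
  obtain ⟨C, rfl⟩ :=
    (inducedEquiv B D (fundamentalChamber b (arr P (B ∪ D))) (chamber hx)).surjective S
  obtain ⟨C', rfl⟩ :=
    (inducedEquiv B D (fundamentalChamber b (arr P (B ∪ D))) (chamber hx)).surjective T
  simp only [Equiv.trans_apply, Equiv.symm_apply_apply]
  rw [stepLE_inducedEquiv_iff hA, stepLE_inducedEquiv_iff hA]
  exact e.le_iff_le

end Generic

/-! ### Invariance of rank polynomials under the Weyl group and negation. -/

section Translate

variable [Finite ι] [P.IsRootSystem] [P.IsCrystallographic] [P.IsReduced]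

theorem setPoly_realizable_image {A : Set ι} {σ : ι → ι} (hσ : Function.Injective σ)
    (h₁ : ∀ x : N, ∃ y : N, ∀ i, P.root' (σ i) x = P.root' i y)
    (h₂ : ∀ y : N, ∃ x : N, ∀ i, P.root' (σ i) x = P.root' i y) :
    setPoly (realizable P (σ '' A)) = setPoly (realizable P A) := by
  have key : ∀ x y : N, (∀ i, P.root' (σ i) x = P.root' i y) →
      (Regular P (σ '' A) x ↔ Regular P A y) ∧ negSet P (σ '' A) x = σ '' negSet P A y := by
    intro x y h
    constructor
    · rw [Regular, Set.forall_mem_image]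
      exact forall₂_congr fun i _ => by rw [h]
    · ext j
      constructor
      · rintro ⟨⟨i, hi, rfl⟩, hj⟩
        exact ⟨i, ⟨hi, h i ▸ hj⟩, rfl⟩
      · rintro ⟨i, ⟨hi, hj⟩, rfl⟩
        exact ⟨⟨i, hi, rfl⟩, (h i).symm ▸ hj⟩
  let f : realizable P A → realizable P (σ '' A) := fun T => ⟨σ '' T.1, by
    obtain ⟨_, y, hy, rfl⟩ := T
    obtain ⟨x, hx⟩ := h₂ y
    exact ⟨x, (key x y hx).1.mpr hy, (key x y hx).2.symm⟩⟩
  have hf : Function.Bijective f := by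
    constructor
    · intro S T h
      exact Subtype.ext (hσ.image_injective (congrArg Subtype.val h))
    · rintro ⟨_, x, hx, rfl⟩
      obtain ⟨y, hy⟩ := h₁ x
      exact ⟨⟨_, y, (key x y hy).1.mp hx, rfl⟩, Subtype.ext (key x y hy).2.symm⟩
  exact (setPoly_eq_of_equiv (Equiv.ofBijective f hf) fun T =>
    Set.ncard_image_of_injective T.1 hσ).symm

theorem setPoly_realizable_smul (g : P.weylGroup) (A : Set ι) :
    setPoly (realizable P ((fun i => g • i) '' A)) = setPoly (realizable P A) := by
  refine setPoly_realizable_image (smul_injective_idx g) (fun x => ⟨act g⁻¹ x, fun i => ?_⟩)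
    fun y => ⟨act g y, fun i => ?_⟩
  · rw [root'_act, inv_inv]
  · rw [root'_act, inv_smul_smul]

theorem setPoly_realizable_neg (A : Set ι) :
    setPoly (realizable P ((fun i => P.reflectionPerm i i) '' A)) = setPoly (realizable P A) := by
  refine setPoly_realizable_image (fun i j h => ?_) (fun x => ⟨-x, fun i => ?_⟩)
    fun x => ⟨-x, fun i => ?_⟩
  · apply P.root.injective
    rw [← neg_inj, ← root_neg, ← root_neg]
    exact congrArg P.root h
  · rw [root'_neg, map_neg]
  · rw [root'_neg, map_neg, neg_neg]

theorem translatedArr_eq (b : P.Base) (g w : P.weylGroup) :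
    translatedArr b g w = arr P ((fun i => g • i) '' inversions b w) := by
  rw [arr, Set.image_image]
  rfl

end Translate

/-! ### The inversion arrangement of a product `u * v`. -/

section Decomposition

variable [Finite ι] [P.IsRootSystem] [P.IsCrystallographic] [P.IsReduced] {b : P.Base}

theorem inversions_subset_isPos (w : P.weylGroup) : inversions b w ⊆ {i | b.IsPos i} :=
  fun _ hi => hi.1

theorem distPoly_eq (w : P.weylGroup) : distPoly b w = setPoly (realizable P (inversions b w)) :=
  distPoly_eq_setPoly (inversions_subset_isPos w)

theorem inversions_inv (w : P.weylGroup) : inversions b w⁻¹ =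
    (fun i => P.reflectionPerm i i) '' ((fun i => w • i) '' inversions b w) := by
  have hneg : ∀ i, P.reflectionPerm (P.reflectionPerm i i) (P.reflectionPerm i i) = i := fun i =>
    P.root.injective (by rw [root_neg, root_neg, neg_neg])
  ext i
  rw [mem_inversions_inv]
  constructor
  · intro h
    refine ⟨_, ⟨_, h, rfl⟩, ?_⟩
    dsimp only
    rw [smul_neg, smul_inv_smul, hneg]
  · rintro ⟨_, ⟨j, hj, rfl⟩, rfl⟩
    rwa [smul_neg, inv_smul_smul, hneg]

theorem distPoly_inv (w : P.weylGroup) : distPoly b w⁻¹ = distPoly b w := by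
  rw [distPoly_eq, distPoly_eq, inversions_inv, setPoly_realizable_neg, setPoly_realizable_smul]

/-- Chambers of `Φ_K` correspond to elements of `W_K`, which form the Bruhat interval below the
longest element; distance becomes length. -/
theorem setPoly_realizable_of_isLongest {K : Set b.support} {g : P.weylGroup}
    (hg : IsLongest b K g) :
    setPoly (realizable P (inversions b g)) = poincarePoly b g := by
  rw [inversions_of_isLongest hg]
  let f : {y : P.weylGroup // BruhatLE b y g} → realizable P (posRoots b K) := fun y =>
    ⟨inversions b y.1, by
      obtain ⟨z, hz⟩ := exists_point (b := b) y.1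
      have e : ∀ i, P.root' i z < 0 ↔ ¬ b.IsPos (y.1 • i) := fun i => by
        rw [← isPos_neg_iff, ← smul_neg, ← hz, root'_neg, neg_pos]
      refine ⟨z, fun i _ h => ?_, ?_⟩
      · by_cases hi : b.IsPos (y.1 • i)
        · exact ((hz i).mpr hi).ne' h
        · exact ((e i).mpr hi).ne h
      · have hy := inversions_subset_posRoots (y.2.mem_parabolic hg.1)
        ext i
        exact ⟨fun h => ⟨hy h, (e i).mpr h.2⟩, fun h => ⟨h.1.1, (e i).mp h.2⟩⟩⟩
  have hf : Function.Bijective f := by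
    constructor
    · intro y y' h
      exact Subtype.ext (eq_of_inversions_eq b (congrArg Subtype.val h))
    · rintro ⟨_, x, -, rfl⟩
      obtain ⟨y, hy, hyx⟩ := exists_mem_parabolic_inversions_eq K x
      exact ⟨⟨y, BruhatLE.of_isLongest hg hy⟩, Subtype.ext hyx⟩
  unfold setPoly poincarePoly
  rw [← finsum_comp_equiv (Equiv.ofBijective f hf)]
  exact finsum_congr fun y => by rw [length_eq_ncard]; rfl

/-- After translation by `v` the sets lie in `Φ_{I ∩ J}`, `Φ_J` and `Φ_I`: `v Inv(v)` is the
negative of `Inv(v⁻¹)`, and `v⁻¹ ∈ W_I`. Then `exists_amalgam` applies. -/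
theorem amalgamates_of_parabolic {I J : Set b.support} {u v u₀ : P.weylGroup}
    (hvI : v ∈ parabolic b I) (hu : u ∈ parabolic b J)
    (hu₀ : inversions b u₀ = posRoots b (I ∩ J)) :
    Amalgamates P ((fun i => v⁻¹ • i) '' inversions b u₀) ((fun i => v⁻¹ • i) '' inversions b u)
      (inversions b v) := by
  intro x y hx hy hxy
  obtain ⟨z, hz, hzI, hzJ⟩ := exists_amalgam I J (act v x) (act v y) (by
    rw [← hu₀]
    intro i hi
    rw [root'_act, root'_act]
    have := Set.ext_iff.mp hxy (v⁻¹ • i)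
    have hi' : v⁻¹ • i ∈ (fun i => v⁻¹ • i) '' inversions b u₀ := ⟨i, hi, rfl⟩
    exact ⟨fun h => (this.mp ⟨hi', h⟩).2, fun h => (this.mpr ⟨hi', h⟩).2⟩)
  have hval : ∀ i, P.root' i (act v⁻¹ z) = P.root' (v • i) z := fun i => by
    rw [root'_act, inv_inv]
  refine ⟨act v⁻¹ z, fun i _ => hval i ▸ hz _, ?_, ?_⟩
  · ext j
    refine and_congr_right ?_
    rintro ⟨i, hi, rfl⟩
    rw [hval, smul_inv_smul, hzJ i (inversions_subset_posRoots hu hi), root'_act]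
  · ext i
    refine and_congr_right fun hi => ?_
    have h1 : P.reflectionPerm (v • i) (v • i) ∈ inversions b v⁻¹ := by
      rw [inversions_inv]
      exact ⟨_, ⟨i, hi, rfl⟩, rfl⟩
    have h2 := hzI _ (inversions_subset_posRoots (inv_mem hvI) h1)
    rw [root'_neg, root'_neg, root'_act, inv_smul_smul, neg_lt_zero, neg_lt_zero] at h2
    rw [hval]
    rcases lt_or_gt_of_ne (hz (v • i)) with h3 | h3
    · refine iff_of_true h3 (lt_of_le_of_ne ?_ (hx i (Or.inr hi)))
      exact not_lt.mp fun h4 => lt_asymm h3 (h2.mpr h4)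
    · exact iff_of_false h3.not_gt (h2.mp h3).not_gt

theorem empty_mem_fibre {J : Set b.support} {v u₀ : P.weylGroup} (hv : v ∈ minCosetReps b J)
    (hu₀ : u₀ ∈ parabolic b J) :
    ∀ n ∈ realizable P ((fun i => v⁻¹ • i) '' inversions b u₀),
      ∅ ∈ fibre P ((fun i => v⁻¹ • i) '' inversions b u₀) n (inversions b v) := by
  classical
  rintro _ ⟨y, hy, rfl⟩
  -- Translated by `v⁻¹`, this point is zero on `v⁻¹Φ_J` and negative on `Inv(v)`. Subtracting a
  -- large multiple makes `Inv(v)` positive without disturbing the signs on `v⁻¹Inv(u₀)`.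
  obtain ⟨t, ht⟩ := exists_root'_eq b (fun k => if k ∈ J then 0 else 1)
  have ht0 : ∀ i ∈ posRoots b J, P.root' i t = 0 := fun i hi => by
    rw [root'_eq_sum_coeff b]
    refine Finset.sum_eq_zero fun k _ => ?_
    by_cases hk : k ∈ J
    · rw [ht, if_pos hk, mul_zero]
    · rw [hi.2 k hk, zero_mul]
  have htpos : ∀ i, b.IsPos i → i ∉ posRoots b J → 0 < P.root' i t := fun i hi hiJ => by
    have : ∃ k ∉ J, coeff b i k ≠ 0 := by
      by_contra! h
      exact hiJ ⟨hi, h⟩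
    obtain ⟨k, hk, hik⟩ := this
    rw [root'_eq_sum_coeff b]
    refine Finset.sum_pos' (fun l _ => mul_nonneg (coeff_nonneg b hi l) ?_)
      ⟨k, Finset.mem_univ k, ?_⟩
    · rw [ht]
      split_ifs <;> norm_num
    · rw [ht, if_neg hk, mul_one]
      exact lt_of_le_of_ne (coeff_nonneg b hi k) hik.symm
  have hD : ∀ i ∈ inversions b v, P.root' (v • i) t < 0 := fun i hi => by
    have h1 : b.IsPos (P.reflectionPerm (v • i) (v • i)) := (isPos_neg_iff b _).mpr hi.2
    have h2 : P.reflectionPerm (v • i) (v • i) ∉ posRoots b J := fun h => by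
      have h3 := isPos_inv_smul_of_mem_minCosetReps hv h
      rw [smul_neg, isPos_neg_iff, inv_smul_smul] at h3
      exact h3 hi.1
    have := htpos _ h1 h2
    rwa [root'_neg, neg_pos] at this
  -- The multiple used is `s + 1`, since `s` itself would only give nonnegative values on `Inv(v)`.
  obtain ⟨s, hs⟩ := (Set.finite_range fun i => P.root' i y / P.root' (v • i) t).bddAbove
  have hval : ∀ i, P.root' i (y - (s + 1) • act v⁻¹ t) =
      P.root' i y - (s + 1) * P.root' (v • i) t := fun i => by
    rw [map_sub, map_smul, smul_eq_mul, root'_act, inv_inv]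
  have hB : ∀ i ∈ (fun i => v⁻¹ • i) '' inversions b u₀,
      P.root' i (y - (s + 1) • act v⁻¹ t) = P.root' i y := by
    rintro _ ⟨i, hi, rfl⟩
    rw [hval, smul_inv_smul, ht0 i (inversions_subset_posRoots hu₀ hi), mul_zero, sub_zero]
  have hDpos : ∀ i ∈ inversions b v, 0 < P.root' i (y - (s + 1) • act v⁻¹ t) := fun i hi => by
    have h1 : P.root' i y / P.root' (v • i) t ≤ s := hs ⟨i, rfl⟩
    rw [div_le_iff_of_neg (hD i hi)] at h1
    have := hD i hi
    rw [hval]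
    linarith
  refine ⟨y - (s + 1) • act v⁻¹ t, ?_, ?_, ?_⟩
  · rintro i (hi | hi)
    · rw [hB i hi]
      exact hy i hi
    · exact (hDpos i hi).ne'
  · ext i
    exact and_congr_right fun hi => by rw [hB i hi]
  · ext i
    simp only [Set.mem_empty_iff_false, iff_false]
    exact fun h => lt_asymm h.2 (hDpos i h.1)

/-- For `k` in `J` and in the support of `v`, `u s_k` lies in `W_J` and below `u * v`, hence below
`u`. So `k` is a descent of `u`, and positive combinations of such roots are inverted too. -/
theorem posRoots_subset_of_isMaxBelow {J : Set b.support} {u v : P.weylGroup}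
    (hv : v ∈ minCosetReps b J) (hmax : IsMaxBelow b (u * v) J u) :
    posRoots b (wordSupport b v ∩ J) ⊆ inversions b u := by
  refine fun i hi => ⟨hi.1, not_isPos_smul_of_mem_posRoots hi fun k hk h => ?_⟩
  have h1 := (BruhatLE.refl u).mul (simple_bruhatLE_of_mem_wordSupport hk.1)
    (length_mul_of_mem_minCosetReps hmax.1 hv)
  have h2 := (hmax.2.2 _ (mul_mem hmax.1 (simple_mem_parabolic hk.2)) h1).length_le
  have h3 := length_mul_simple b h
  omega

end Decomposition

/-! ### Poset isomorphisms and the polynomial identity. -/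

section Consequences

variable [Finite ι] [P.IsRootSystem] [P.IsCrystallographic] [P.IsReduced] {b : P.Base}

theorem inversions_mul_of_mem_minCosetReps {J : Set b.support} {u v : P.weylGroup}
    (hu : u ∈ parabolic b J) (hv : v ∈ minCosetReps b J) :
    inversions b (u * v) = (fun i => v⁻¹ • i) '' inversions b u ∪ inversions b v := by
  rw [inversions_mul b (isPos_inv_smul_of_mem_inversions hu hv), Set.union_comm]

theorem exists_eq_mul_of_inversions_subset {u u₀ : P.weylGroup}
    (h : inversions b u₀ ⊆ inversions b u) :
    ∃ u', u = u' * u₀ ∧ length b u = length b u' + length b u₀ := by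
  refine ⟨u * u₀⁻¹, (inv_mul_cancel_right u u₀).symm, ?_⟩
  have h1 := length_mul b (g := u * u₀⁻¹) (h := u₀) fun i hi =>
    isPos_inv_smul_of_subset b (by rwa [inv_mul_cancel_right]) hi
  rwa [inv_mul_cancel_right] at h1

theorem nonempty_orderIso_of_amalgamates {B₀ B D : Set ι} (hB : B₀ ⊆ B)
    (hA : B ∪ D ⊆ {i | b.IsPos i}) (h : Amalgamates P B₀ B D)
    (r : Arrangement.Chamber (arr P B)) (r' : Arrangement.Chamber (arr P B₀))
    (hr : r.carrier ⊆ r'.carrier) :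
    Nonempty
      (Arrangement.InducedPoset (arr P (B ∪ D)) (fundamentalChamber b (arr P (B ∪ D))) r.carrier ≃o
        Arrangement.InducedPoset (arr P (B₀ ∪ D)) (fundamentalChamber b (arr P (B₀ ∪ D)))
          r'.carrier) := by
  refine nonempty_orderIso_of_fibre_eq hA ((Set.union_subset_union_left D hB).trans hA) r r' ?_
  rw [fibre_eq_of_amalgamates hB h (regionNeg_mem_realizable r), (subset_chamber_iff hB r r').mp hr]

/-- With `I` the support of `v`, both factors lie in `W_I`; an element of `W_J` below their product
lies in `W_{I ∩ J}`, hence below `u₀`. -/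
theorem poincarePoly_longest_mul {J : Set b.support} {v u₀ : P.weylGroup}
    (hv : v ∈ minCosetReps b J) (hu₀ : IsLongest b (wordSupport b v ∩ J) u₀) :
    poincarePoly b (u₀ * v) = poincarePoly b u₀ * relPoincarePoly b J v := by
  refine poincarePoly_mul (parabolic_mono Set.inter_subset_right hu₀.1) hv fun x hx h => ?_
  exact BruhatLE.of_isLongest hu₀ (mem_parabolic_inter (h.mem_parabolic (mul_mem
    (parabolic_mono Set.inter_subset_left hu₀.1) (mem_parabolic_wordSupport v))) hx)

theorem distPoly_eq_poincarePoly_of_uniform {J : Set b.support} {u v u₀ : P.weylGroup}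
    (hv : v ∈ minCosetReps b J) (hmax : IsMaxBelow b (u * v) J u)
    (hu₀ : IsLongest b (wordSupport b v ∩ J) u₀)
    (hU : Arrangement.Uniform (inversionArr b (u₀ * v))
      (fundamentalChamber b (inversionArr b (u₀ * v))) (translatedArr b v⁻¹ u₀))
    (h₀ : distPoly b (u₀ * v) = poincarePoly b (u₀ * v))
    (h : distPoly b u = poincarePoly b u) :
    distPoly b (u * v) = poincarePoly b (u * v) := by
  have hu₀J : u₀ ∈ parabolic b J := parabolic_mono Set.inter_subset_right hu₀.1
  have hB : (fun i => v⁻¹ • i) '' inversions b u₀ ⊆ (fun i => v⁻¹ • i) '' inversions b u :=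
    Set.image_mono ((inversions_of_isLongest hu₀).trans_subset
      (posRoots_subset_of_isMaxBelow hv hmax))
  have hpos := inversions_subset_isPos (b := b) (u₀ * v)
  have ham := amalgamates_of_parabolic (mem_parabolic_wordSupport v) hmax.1
    (inversions_of_isLongest hu₀)
  rw [translatedArr_eq, show inversionArr b (u₀ * v) = arr P (inversions b (u₀ * v)) from rfl,
    inversions_mul_of_mem_minCosetReps hu₀J hv] at hU
  rw [inversions_mul_of_mem_minCosetReps hu₀J hv] at hpos
  rw [distPoly_eq, inversions_mul_of_mem_minCosetReps hu₀J hv, poincarePoly_longest_mul hv hu₀,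
    ← setPoly_realizable_of_isLongest hu₀] at h₀
  rw [distPoly_eq] at h
  rw [distPoly_eq, inversions_mul_of_mem_minCosetReps hmax.1 hv,
    poincarePoly_mul hmax.1 hv hmax.2.2, ← h, ← setPoly_realizable_smul v⁻¹ (inversions b u)]
  -- The hypothesis on `u₀ * v` reads `P_{u₀}` times the common fibre polynomial equals `P_{u₀}`
  -- times the relative Poincaré polynomial; cancel the nonzero `P_{u₀}`.
  have hfib : ∀ n ∈ realizable P ((fun i => v⁻¹ • i) '' inversions b u₀),
      setPoly (fibre P ((fun i => v⁻¹ • i) '' inversions b u₀) n (inversions b v)) =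
        relPoincarePoly b J v := by
    intro n hn
    rw [setPoly_realizable_union (disjoint_inversions_mul b u₀ v).symm fun n' hn' =>
      setPoly_fibre_eq_of_uniform hpos (empty_mem_fibre hv hu₀J) hU hn' hn,
      setPoly_realizable_smul] at h₀
    refine mul_left_cancel₀ ?_ h₀
    rw [setPoly_realizable_of_isLongest hu₀]
    exact poincarePoly_ne_zero u₀
  exact setPoly_realizable_union (disjoint_inversions_mul b u v).symm fun n hn => by
    rw [fibre_eq_of_amalgamates hB ham hn, hfib _ (inter_mem_realizable hB hn)]

end Consequences

end Weyl

end

theorem mainTheorem10 {ι M N : Type*} [Finite ι]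
    [AddCommGroup M] [Module ℝ M] [AddCommGroup N] [Module ℝ N]
    (P : RootPairing ι ℝ M N) [P.IsRootSystem] [P.IsCrystallographic] [P.IsReduced]
    (b : P.Base) (α : b.support) (w u v u₀ : P.weylGroup)
    (hBP : Weyl.IsBPDecomposition b α w u v)
    (hu₀ : Weyl.IsLongest b (Weyl.wordSupport b v ∩ {α}ᶜ) u₀)
    (𝒜₀ 𝒜₁ 𝒜₂ : Set (Submodule ℝ N))
    (h𝒜₀ : 𝒜₀ = Weyl.translatedArr b v⁻¹ u₀)
    (h𝒜₁ : 𝒜₁ = Weyl.translatedArr b v⁻¹ u \ 𝒜₀)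
    (h𝒜₂ : 𝒜₂ = Weyl.inversionArr b w \ Weyl.translatedArr b v⁻¹ u) :
    -- the decomposition
    (∃ u' : P.weylGroup, u = u' * u₀ ∧
      Weyl.length b u = Weyl.length b u' + Weyl.length b u₀) ∧
    (𝒜₁ ∪ 𝒜₀ = Weyl.translatedArr b v⁻¹ u ∧ 𝒜₀ ∪ 𝒜₁ ∪ 𝒜₂ = Weyl.inversionArr b w ∧
      Disjoint 𝒜₀ 𝒜₁ ∧ Disjoint 𝒜₀ 𝒜₂ ∧ Disjoint 𝒜₁ 𝒜₂ ∧
      𝒜₀ ∪ 𝒜₂ = Weyl.inversionArr b (u₀ * v)) ∧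
    -- the induced chamber posets
    (∀ (r : Arrangement.Chamber (𝒜₁ ∪ 𝒜₀)) (r' : Arrangement.Chamber 𝒜₀),
      r.carrier ⊆ r'.carrier →
      Nonempty
        (Arrangement.InducedPoset (Weyl.inversionArr b w)
            (Weyl.fundamentalChamber b (Weyl.inversionArr b w)) r.carrier ≃o
          Arrangement.InducedPoset (𝒜₀ ∪ 𝒜₂)
            (Weyl.fundamentalChamber b (𝒜₀ ∪ 𝒜₂)) r'.carrier)) ∧
    -- the consequence for the polynomials
    (Arrangement.Uniform (Weyl.inversionArr b (u₀ * v))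
        (Weyl.fundamentalChamber b (Weyl.inversionArr b (u₀ * v))) 𝒜₀ →
      Weyl.distPoly b (u₀ * v) = Weyl.poincarePoly b (u₀ * v) →
      Weyl.distPoly b u = Weyl.poincarePoly b u →
      Weyl.distPoly b w = Weyl.poincarePoly b w ∧
        Weyl.distPoly b w⁻¹ = Weyl.poincarePoly b w⁻¹) := by
  obtain ⟨-, rfl, hu, hv, hmax⟩ := hBP
  have hu₀J : u₀ ∈ Weyl.parabolic b {α}ᶜ := Weyl.parabolic_mono Set.inter_subset_right hu₀.1
  have hsub : Weyl.inversions b u₀ ⊆ Weyl.inversions b u :=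
    (Weyl.inversions_of_isLongest hu₀).trans_subset (Weyl.posRoots_subset_of_isMaxBelow hv hmax)
  have hsub' := Set.image_mono (f := fun i => v⁻¹ • i) hsub
  have hw := Weyl.inversions_mul_of_mem_minCosetReps hu hv
  have hw₀ := Weyl.inversions_mul_of_mem_minCosetReps hu₀J hv
  have hpos := Weyl.inversions_subset_isPos (b := b) (u * v)
  rw [hw] at hpos
  have ew : Weyl.inversionArr b (u * v) = Weyl.arr P (Weyl.inversions b (u * v)) := rfl
  have ew₀ : Weyl.inversionArr b (u₀ * v) = Weyl.arr P (Weyl.inversions b (u₀ * v)) := rfl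
  rw [hw] at ew
  rw [hw₀] at ew₀
  have eu := Weyl.translatedArr_eq b v⁻¹ u
  have eu₀ := h𝒜₀.trans (Weyl.translatedArr_eq b v⁻¹ u₀)
  -- Distinct positive roots have distinct hyperplanes, so disjointness passes from root sets to
  -- arrangements.
  have hdisj : Disjoint (Weyl.arr P ((fun i => v⁻¹ • i) '' Weyl.inversions b u))
      (Weyl.arr P (Weyl.inversions b v)) := by
    rw [Set.disjoint_iff_inter_eq_empty, Weyl.arr, Weyl.arr,
      ← Weyl.hyperplane_injOn.image_inter (Set.subset_union_left.trans hpos)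
        (Set.subset_union_right.trans hpos),
      (Weyl.disjoint_inversions_mul b u v).symm.inter_eq, Set.image_empty]
  have hle : 𝒜₀ ⊆ Weyl.translatedArr b v⁻¹ u := by
    rw [eu₀, eu]
    exact Set.image_mono hsub'
  have e₁ : 𝒜₁ ∪ 𝒜₀ = Weyl.translatedArr b v⁻¹ u := by
    rw [h𝒜₁]
    exact Set.sdiff_union_of_subset hle
  have e₂ : 𝒜₂ = Weyl.arr P (Weyl.inversions b v) := by
    rw [h𝒜₂, ew, eu, Weyl.arr, Weyl.arr, Set.image_union, Set.union_sdiff_left]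
    exact hdisj.symm.sdiff_eq_left
  have e₁₂ : Disjoint (Weyl.translatedArr b v⁻¹ u) 𝒜₂ := by rwa [eu, e₂]
  have e₀₂ : 𝒜₀ ∪ 𝒜₂ = Weyl.inversionArr b (u₀ * v) := by
    rw [eu₀, e₂, ew₀]
    exact (Set.image_union ..).symm
  refine ⟨Weyl.exists_eq_mul_of_inversions_subset hsub, ⟨e₁, ?_, ?_, e₁₂.mono_left hle, ?_, e₀₂⟩,
    ?_, fun hU h₀ h => ?_⟩
  · rw [Set.union_comm 𝒜₀, e₁, eu, e₂, ew]
    exact (Set.image_union ..).symm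
  · rw [h𝒜₁]
    exact disjoint_sdiff_self_right
  · exact e₁₂.mono_left (Set.subset_union_left.trans e₁.subset)
  · rw [e₁, eu, e₀₂, ew₀, ew, eu₀]
    exact Weyl.nonempty_orderIso_of_amalgamates hsub' hpos
      (Weyl.amalgamates_of_parabolic (Weyl.mem_parabolic_wordSupport v) hu
        (Weyl.inversions_of_isLongest hu₀))
  · rw [h𝒜₀] at hU
    have := Weyl.distPoly_eq_poincarePoly_of_uniform hv hmax hu₀ hU h₀ h
    exact ⟨this, by rw [Weyl.distPoly_inv, Weyl.poincarePoly_inv, this]⟩
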